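/- Let $k$ be a field. An affine algebraic rack over $k$ is a pointed rack object $(Q,\triangleright,\triangleright^{-1},e)$ in the category of $k$-schemes whose underlying scheme is affine and of finite type over $k$; on generalized points, $(x\triangleright y)\triangleright^{-1}x=y=x\triangleright(y\triangleright^{-1}x)$, $x\triangleright(y\triangleright z)=(x\triangleright y)\triangleright(x\triangleright z)$, $(x\triangleright^{-1}y)\triangleright^{-1}z=(x\triangleright^{-1}z)\triangleright^{-1}(y\triangleright^{-1}z)$, $e\triangleright x=x$ and $x\triangleright e=e$. A morphism of affine algebraic racks is a morphism of $k$-schemes that preserves $\triangleright$, $\triangleright^{-1}$ and $e$. Write $Q=\operatorname{Spec}(A)$, $\nabla=\triangleright^\sharp\colon A\to A\otimes_k A$ and $\varepsilon=e^\sharp\colon A\to k$, and let $\mathfrak q=\operatorname{Der}_k(A,k)$ be the space of $k$-linear maps $D\colon A\to k$ with $D(fg)=D(f)\varepsilon(g)+\varepsilon(f)D(g)$. A Leibniz algebra over $k$ is a vector space with a bilinear bracket such that $[X,[Y,Z]]=[[X,Y],Z]+[Y,[X,Z]]$; its homomorphisms are the bracket-preserving linear maps. **(1) Functor.** For $D,E\in\mathfrak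 q$ the map $[D,E]:=(D\otimes E)\circ\nabla$ lies in $\mathfrak q$, and $(\mathfrak q,[\cdot,\cdot])$ is a Leibniz algebra. For a morphism $\phi\colon Q\to R$ of affine algebraic racks, $(d\phi)_e(D)=D\circ\phi^\sharp$ defines a homomorphism of Leibniz algebras $\mathfrak q\to\mathfrak r$, and $Q\mapsto(\mathfrak q,[\cdot,\cdot])$, $\phi\mapsto(d\phi)_e$ is a covariant functor from affine algebraic racks over $k$ to Leibniz algebras over $k$. **(2) Adjoint representation.** For every commutative $k$-algebra $R$, the canonical map identifies $R\otimes_k\mathfrak q$ with the space $\operatorname{Der}_R(R\otimes_k A,R)$ of derivations at the unit of $Q_R$. There is a unique morphism of $k$-schemes $\mathrm{Ad}\colon Q\to\mathrm{GL}(\mathfrak q)$ such that every $R$-point $x$ of $Q$ acts on $R\otimes_k\mathfrak q$ by $\mathrm{Ad}_x=(dL_x)_e\colon E\mapsto E\circ L_x^\sharp$, where $L_x\colon Q_R\to Q_R$ is left multiplication by $x$. Its derivative $\mathrm{ad}=(d\,\mathrm{Ad})_e\colon\mathfrak q\to\operatorname{End}(\mathfrak q)$ at $e$ is $\mathrm{ad}_D(E)=[D,E]$.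 Here $\operatorname{End}(\mathfrak q)$ is identified with the tangent space of $\mathrm{GL}(\mathfrak q)$ at the identity, so $\mathrm{ad}_D$ is defined by $\mathrm{Ad}_{\varepsilon+\delta D}=\mathrm{id}+\delta\,\mathrm{ad}_D$ over $k[\delta]/(\delta^2)$. **(3) Groups.** Let $G=\operatorname{Spec}(A)$ be an affine algebraic group with comultiplication $\Delta$ and counit $\varepsilon$, and let $Q=\operatorname{Conj}(G)$ be its conjugation quandle scheme: $g\triangleright h=ghg^{-1}$, $h\triangleright^{-1}g=g^{-1}hg$, with the unit of $G$. Then $(\mathfrak q,[\cdot,\cdot])$ is the Lie algebra of $G$: $[D,E]=(D\otimes E-E\otimes D)\circ\Delta$, and $T\mapsto\varepsilon\circ T$ is a bracket-preserving linear isomorphism from the Lie algebra of left-invariant derivations $T\colon A\to A$ (those with $\Delta\circ T=(\mathrm{id}\otimes T)\circ\Delta$, under the commutator) onto $\mathfrak q$. **(4) Lie racks.** Let $k=\mathbb R$ or $\mathbb C$, let $Q=\operatorname{Spec}(A)$ be an affine algebraic rack, and suppose that $Q(k)=\operatorname{Hom}_k(A,k)$, with the pointed rack structure induced from $Q$, is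 a Lie rack. This means that $Q(k)$ carries the structure of a finite-dimensional smooth manifold over $k$ (a complex manifold if $k=\mathbb C$) with smooth rack operations, and that for some closed embedding of $Q$ into an affine space $\mathbb A^n$ the set $Q(k)$ is in this way an embedded submanifold of $k^n$. Give $T_eQ(k)$ the bracket $[X,Y]=\mathrm{ad}_X(Y)$ of the Lie rack $Q(k)$, where $\mathrm{Ad}_x=(dL_x)_e$ and $\mathrm{ad}=(d\,\mathrm{Ad})_e$ are the (existing) derivatives in the sense of manifolds. Then $$\theta\colon T_eQ(k)\to\mathfrak q,\qquad \theta(v)(f)=df_e(v)\quad(f\in A)$$ is an injective linear map that preserves brackets. If, moreover, the scheme $Q$ is smooth over $k$ at $e$, then $\theta$ is bijective, so that $(\mathfrak q,[\cdot,\cdot])$ is the Leibniz algebra of the Lie rack $Q(k)$. -/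

import Mathlib

noncomputable section

namespace AlgRack

open CategoryTheory MonoidalCategory CartesianMonoidalCategory AlgebraicGeometry
open scoped TensorProduct Manifold ContDiff MonObj

universe u v w

section RackObjects

/-- A pointed rack object in a cartesian monoidal category: `op` is `▷`, `invOp` is `▷⁻¹`. The
projections of `X ⊗ X ⊗ X` are `fst`, `snd ≫ fst`, `snd ≫ snd`. -/
structure PtdRackObj (C : Type u) [Category.{v} C] [CartesianMonoidalCategory C] where
  X : C
  op : X ⊗ X ⟶ X
  invOp : X ⊗ X ⟶ X
  unit : 𝟙_ C ⟶ X
  /-- `(y, x ▷⁻¹ y) ↦ (y ▷ (x ▷⁻¹ y), y)` gives back `(x, y)`. -/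
  invOp_op : lift (snd X X) invOp ≫ lift op (fst X X) = 𝟙 (X ⊗ X)
  /-- `(x ▷ y, x) ↦ (x, (x ▷ y) ▷⁻¹ x)` gives back `(x, y)`. -/
  op_invOp : lift op (fst X X) ≫ lift (snd X X) invOp = 𝟙 (X ⊗ X)
  /-- `x ▷ (y ▷ z) = (x ▷ y) ▷ (x ▷ z)`. -/
  left_distrib :
    lift (fst X (X ⊗ X)) (snd X (X ⊗ X) ≫ op) ≫ op =
      lift (lift (fst X (X ⊗ X)) (snd X (X ⊗ X) ≫ fst X X) ≫ op)
        (lift (fst X (X ⊗ X)) (snd X (X ⊗ X) ≫ snd X X) ≫ op) ≫ op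
  /-- `(x ▷⁻¹ y) ▷⁻¹ z = (x ▷⁻¹ z) ▷⁻¹ (y ▷⁻¹ z)`. -/
  right_distrib :
    lift (lift (fst X (X ⊗ X)) (snd X (X ⊗ X) ≫ fst X X) ≫ invOp)
        (snd X (X ⊗ X) ≫ snd X X) ≫ invOp =
      lift (lift (fst X (X ⊗ X)) (snd X (X ⊗ X) ≫ snd X X) ≫ invOp)
        (snd X (X ⊗ X) ≫ invOp) ≫ invOp
  /-- `e ▷ x = x`. -/
  fixing : lift (toUnit X ≫ unit) (𝟙 X) ≫ op = 𝟙 X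
  /-- `x ▷ e = e`. -/
  fixed : lift (𝟙 X) (toUnit X ≫ unit) ≫ op = toUnit X ≫ unit

variable {C : Type u} [Category.{v} C] [CartesianMonoidalCategory C]

/-- Morphisms of pointed rack objects. -/
@[ext]
structure PtdRackHom (Q R : PtdRackObj C) where
  hom : Q.X ⟶ R.X
  op_hom : Q.op ≫ hom = (hom ⊗ₘ hom) ≫ R.op
  invOp_hom : Q.invOp ≫ hom = (hom ⊗ₘ hom) ≫ R.invOp
  unit_hom : Q.unit ≫ hom = R.unit

instance : Category (PtdRackObj C) where
  Hom := PtdRackHom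
  id Q := ⟨𝟙 Q.X, by simp, by simp, by simp⟩
  comp f g := ⟨f.hom ≫ g.hom,
    by rw [← Category.assoc, f.op_hom, Category.assoc, g.op_hom]; simp,
    by rw [← Category.assoc, f.invOp_hom, Category.assoc, g.invOp_hom]; simp,
    by rw [← Category.assoc, f.unit_hom, g.unit_hom]⟩
  id_comp f := by ext; simp
  comp_id f := by ext; simp
  assoc f g h := by ext; simp

/-- The conjugation quandle `Conj(G)` of a group object: on generalized points,
`g ▷ h = g h g⁻¹` and `h ▷⁻¹ g = g⁻¹ h g`. -/
def conj (G : C) [GrpObj G] : PtdRackObj C where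
  X := G
  op := fst G G * snd G G * (fst G G)⁻¹
  invOp := (snd G G)⁻¹ * fst G G * snd G G
  unit := η[G]
  invOp_op := by
    ext <;> simp [MonObj.comp_mul, GrpObj.comp_inv, mul_assoc]
  op_invOp := by
    ext <;> simp [MonObj.comp_mul, GrpObj.comp_inv, mul_assoc]
  left_distrib := by
    simp [MonObj.comp_mul, GrpObj.comp_inv, mul_assoc]
  right_distrib := by
    simp [MonObj.comp_mul, GrpObj.comp_inv, mul_assoc]
  fixing := by
    have : toUnit G ≫ η[G] = 1 := rfl
    simp [MonObj.comp_mul, GrpObj.comp_inv, this]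
  fixed := by
    have : toUnit G ≫ η[G] = 1 := rfl
    simp [MonObj.comp_mul, GrpObj.comp_inv, this]

end RackObjects

section LeibnizAlgebras

/-- The derivation form of the Jacobi identity, `[x, [y, z]] = [[x, y], z] + [y, [x, z]]`. -/
def IsLeibnizBracket {k : Type u} [Field k] {V : Type v} [AddCommGroup V] [Module k V]
    (b : V →ₗ[k] V →ₗ[k] V) : Prop :=
  ∀ x y z : V, b x (b y z) = b (b x y) z + b y (b x z)

/-- (Left) Leibniz algebras over a field. -/
structure LeibAlg (k : Type u) [Field k] where
  carrier : Type u
  [addCommGroup : AddCommGroup carrier]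
  [module : Module k carrier]
  bracket : carrier →ₗ[k] carrier →ₗ[k] carrier
  jacobi : IsLeibnizBracket bracket

attribute [instance] LeibAlg.addCommGroup LeibAlg.module

/-- The Leibniz algebra `(V, b)`. -/
def LeibAlg.of {k : Type u} [Field k] {V : Type u} [AddCommGroup V] [Module k V]
    (b : V →ₗ[k] V →ₗ[k] V) (hb : IsLeibnizBracket b) : LeibAlg k where
  carrier := V
  bracket := b
  jacobi := hb

/-- Homomorphisms of Leibniz algebras. -/
@[ext]
structure LeibHom {k : Type u} [Field k] (V W : LeibAlg k) where
  toLin : V.carrier →ₗ[k] W.carrier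
  map_bracket : ∀ x y, toLin (V.bracket x y) = W.bracket (toLin x) (toLin y)

instance (k : Type u) [Field k] : Category (LeibAlg k) where
  Hom := LeibHom
  id V := ⟨LinearMap.id, fun _ _ => rfl⟩
  comp f g := ⟨g.toLin ∘ₗ f.toLin, fun x y => by simp [f.map_bracket, g.map_bracket]⟩

/-- A bracket-preserving linear map as a homomorphism of Leibniz algebras. -/
def LeibAlg.ofHom {k : Type u} [Field k] {V W : Type u} [AddCommGroup V] [Module k V]
    [AddCommGroup W] [Module k W] {b : V →ₗ[k] V →ₗ[k] V} {hb : IsLeibnizBracket b}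
    {c : W →ₗ[k] W →ₗ[k] W} {hc : IsLeibnizBracket c} (f : V →ₗ[k] W)
    (hf : ∀ x y, f (b x y) = c (f x) (f y)) : LeibAlg.of b hb ⟶ LeibAlg.of c hc :=
  LeibHom.mk (V := LeibAlg.of b hb) (W := LeibAlg.of c hc) f hf

end LeibnizAlgebras

section Schemes

variable {k : Type u} [Field k]

/-- The affine scheme `Spec B` over `Spec k`. -/
def specOver (k : Type u) [Field k] (B : Type u) [CommRing B] [Algebra k B] :
    Over (Spec (.of k)) :=
  Over.mk (Spec.map (CommRingCat.ofHom (algebraMap k B)))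

/-- The morphism of `k`-schemes `Spec B' ⟶ Spec B` of a `k`-algebra homomorphism `B → B'`. -/
def specOverMap {B B' : Type u} [CommRing B] [Algebra k B] [CommRing B'] [Algebra k B']
    (f : B →ₐ[k] B') : specOver k B' ⟶ specOver k B :=
  Over.homMk (Spec.map (CommRingCat.ofHom f.toRingHom)) (by
    simp [specOver, ← Spec.map_comp, ← CommRingCat.ofHom_comp])

/-- The ring `𝒪(X)` of global functions of a `k`-scheme `X`. -/
def Coord (X : Over (Spec (.of k))) : Type u := Γ(X.left, ⊤)

instance (X : Over (Spec (.of k))) : CommRing (Coord X) :=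
  inferInstanceAs (CommRing Γ(X.left, ⊤))

/-- The `k`-algebra structure of `𝒪(X)`, given by the structure morphism `X ⟶ Spec k`. -/
instance (X : Over (Spec (.of k))) : Algebra k (Coord X) :=
  ((Scheme.ΓSpecIso (.of k)).inv ≫ X.hom.appTop).hom.toAlgebra

/-- The pullback `φ^♯ : 𝒪(Y) → 𝒪(X)` of functions along a morphism `φ : X ⟶ Y` of `k`-schemes. -/
def sharp {X Y : Over (Spec (.of k))} (φ : X ⟶ Y) : Coord Y →ₐ[k] Coord X where
  __ := φ.left.appTop.hom
  commutes' r := by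
    have h : Y.hom.appTop ≫ φ.left.appTop = X.hom.appTop := by
      rw [← Scheme.Hom.comp_appTop, Over.w φ]
    exact congr(($h).hom ((Scheme.ΓSpecIso (.of k)).inv.hom r))

/-- The identification `𝒪(Spec B) = B`. -/
def coordSpec (B : Type u) [CommRing B] [Algebra k B] : Coord (specOver k B) →ₐ[k] B where
  __ := (Scheme.ΓSpecIso (.of B)).hom.hom
  commutes' r := by
    have h : (Scheme.ΓSpecIso (.of k)).inv ≫ (specOver k B).hom.appTop ≫
        (Scheme.ΓSpecIso (.of B)).hom = CommRingCat.ofHom (algebraMap k B) := by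
      rw [Iso.inv_comp_eq]
      exact Scheme.ΓSpecIso_naturality _
    exact congr(($h).hom r)

/-- The isomorphism `Spec 𝒪(X) ⟶ X` for an affine `k`-scheme `X`. -/
def fromSpec (X : Over (Spec (.of k))) [IsAffine X.left] : specOver k (Coord X) ⟶ X :=
  Over.homMk X.left.isoSpec.inv (by
    have h : X.left.isoSpec.inv ≫ X.hom =
        Spec.map ((Scheme.ΓSpecIso (.of k)).inv ≫ X.hom.appTop) := by
      rw [Spec.map_comp, ← Scheme.isoSpec_Spec_inv]
      exact (Scheme.isoSpec_inv_naturality X.hom).symm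
    exact h)

/-- For an affine `k`-scheme `X` with coordinate ring `A = 𝒪(X)`, the comorphism
`m^♯ : A → A ⊗ A` of a morphism `m : X × X ⟶ X`: the pullback along
`Spec (A ⊗ A) ≅ X × X ⟶ X`. -/
def comorphism {X : Over (Spec (.of k))} [IsAffine X.left] (m : X ⊗ X ⟶ X) :
    Coord X →ₐ[k] Coord X ⊗[k] Coord X :=
  (coordSpec _).comp (sharp
    (lift (specOverMap Algebra.TensorProduct.includeLeft ≫ fromSpec X)
      (specOverMap Algebra.TensorProduct.includeRight ≫ fromSpec X) ≫ m))

/-- The homomorphism `e^♯ : 𝒪(X) → k` of a rational point `e : Spec k ⟶ X`. -/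
def evalAt {X : Over (Spec (.of k))} (e : 𝟙_ (Over (Spec (.of k))) ⟶ X) : Coord X →ₐ[k] k :=
  (coordSpec k).comp (sharp (toUnit (specOver k k) ≫ e))

end Schemes

section AffineRacks

/-- The category of affine algebraic racks over `k`: the full subcategory of pointed rack objects
in `k`-schemes on those whose underlying scheme is affine and of finite type over `k`. -/
abbrev AffRack (k : Type u) [Field k] :=
  ObjectProperty.FullSubcategory fun Q : PtdRackObj (Over (Spec (.of k))) =>
    IsAffine Q.X.left ∧ LocallyOfFiniteType Q.X.hom

variable {k : Type u} [Field k]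

instance (Q : AffRack k) : IsAffine Q.obj.X.left := Q.property.1

namespace AffRack

/-- The coordinate ring `A` of `Q = Spec A`. -/
abbrev coord (Q : AffRack k) : Type u := Coord Q.obj.X

/-- The corack operation `∇ = ▷^♯ : A → A ⊗ A`. -/
def nabla (Q : AffRack k) : Q.coord →ₐ[k] Q.coord ⊗[k] Q.coord := comorphism Q.obj.op

/-- The counit `ε = e^♯ : A → k`. -/
def counit (Q : AffRack k) : Q.coord →ₐ[k] k := evalAt Q.obj.unit

/-- The homomorphism `φ^♯ : 𝒪(R) → 𝒪(Q)` of a morphism `φ : Q ⟶ R` of affine algebraic racks. -/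
def comap {Q R : AffRack k} (φ : Q ⟶ R) : R.coord →ₐ[k] Q.coord := sharp φ.hom.hom

end AffRack

/-- `Der_R(B, R)`, where `R` is a `B`-module through an augmentation `ε : B → R`. -/
def pointDer {R B : Type*} [CommRing R] [CommRing B] [Algebra R B] (ε : B →ₐ[R] R) :
    Submodule R (B →ₗ[R] R) where
  carrier := {D | ∀ f g, D (f * g) = D f * ε g + ε f * D g}
  add_mem' := by
    intro D E hD hE f g
    simp only [LinearMap.add_apply, hD f g, hE f g]
    ring
  zero_mem' := by intro f g; simp
  smul_mem' := by
    intro c D hD f g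
    simp only [LinearMap.smul_apply, smul_eq_mul, hD f g]
    ring

/-- `(D ⊗ E) ∘ ∇` for linear forms `D`, `E` on `A` and a map `∇ : A → A ⊗ A`, where
`k ⊗ k = k`. -/
def convolve {A : Type*} [CommRing A] [Algebra k A] (c : A →ₐ[k] A ⊗[k] A) (D E : A →ₗ[k] k) :
    A →ₗ[k] k :=
  LinearMap.mul' k k ∘ₗ TensorProduct.map D E ∘ₗ c.toLinearMap

instance {A : Type*} [CommRing A] [Algebra k A] (ε : A →ₐ[k] k) : (RingHom.ker ε).IsPrime :=
  RingHom.ker_isPrime ε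

namespace AffRack

/-- `𝔮 = Der_k(A, k)`, the tangent space of `Q` at the unit. -/
abbrev tangent (Q : AffRack k) : Submodule k (Q.coord →ₗ[k] k) := pointDer Q.counit

end AffRack

end AffineRacks

section AdjointRepresentation

variable {k : Type u} [Field k]

/-- A morphism of `k`-schemes from `Spec A` to `GL(V)`, as a natural transformation of functors of
points `Hom(A, R) → GL(R ⊗ V)`. -/
@[ext]
structure MorToGL (A V : Type u) [CommRing A] [Algebra k A] [AddCommGroup V] [Module k V] where
  app : ∀ (R : Type u) [CommRing R] [Algebra k R],
    (A →ₐ[k] R) → ((R ⊗[k] V) ≃ₗ[R] (R ⊗[k] V))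
  naturality : ∀ (R S : Type u) [CommRing R] [Algebra k R] [CommRing S] [Algebra k S]
    (g : R →ₐ[k] S) (x : A →ₐ[k] R) (v : V),
    app S (g.comp x) (1 ⊗ₜ v) = g.toLinearMap.rTensor V (app R x (1 ⊗ₜ v))

/-- The tangent vector `∂D = ε + δ D : A → k[δ]` of a derivation `D`, as a `k[δ]`-point. -/
def dualPoint {A : Type u} [CommRing A] [Algebra k A] (ε : A →ₐ[k] k) (D : pointDer ε) :
    A →ₐ[k] DualNumber k where
  toFun f := TrivSqZeroExt.inl (ε f) + TrivSqZeroExt.inr (D.1 f)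
  map_one' := by
    have h := D.2 1 1
    have h1 : D.1 1 = 0 := by simpa using h
    simp [h1]
  map_mul' f g := by
    have h := D.2 f g
    ext
    · simp
    · simp [h]; ring
  map_zero' := by simp
  map_add' f g := by ext <;> simp
  commutes' r := by
    have h := D.2 1 1
    have h1 : D.1 1 = 0 := by simpa using h
    have h2 : D.1 (algebraMap k A r) = 0 := by
      rw [Algebra.algebraMap_eq_smul_one, map_smul, h1, smul_zero]
    have h3 : algebraMap k (DualNumber k) r = TrivSqZeroExt.inl r := rfl
    simp [h2, h3]

/-- `d : T_e(Spec A) → End(V)` is the derivative at the rational point `ε` of a morphism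
`Φ : Spec A ⟶ GL(V)` with `Φ(ε) = 1`, where `End(V)` is identified with
`T_1 GL(V) = ker (GL(V)(k[δ]) → GL(V)(k))` by `a ↦ 1 + δ a`: the tangent vector `D` is mapped to
the `k[δ]`-point `Φ(∂D) = 1 + δ d(D)`. -/
def MorToGL.HasDerivAt {A V : Type u} [CommRing A] [Algebra k A] [AddCommGroup V] [Module k V]
    (Φ : MorToGL (k := k) A V) (ε : A →ₐ[k] k) (d : pointDer ε →ₗ[k] Module.End k V) : Prop :=
  ∀ (D : pointDer ε) (v : V),
    Φ.app (DualNumber k) (dualPoint ε D) (1 ⊗ₜ v) = 1 ⊗ₜ v + (DualNumber.eps : DualNumber k) ⊗ₜ d D v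

namespace AffRack

variable (Q : AffRack k) (R : Type u) [CommRing R] [Algebra k R]

/-- The counit `R ⊗ A → R` of the base change `Q_R`. -/
def counitBase : R ⊗[k] Q.coord →ₐ[R] R :=
  Algebra.TensorProduct.lift (AlgHom.id R R) ((Algebra.ofId k R).comp Q.counit)
    fun _ _ => Commute.all _ _

/-- The endomorphism `L_x^♯` of `R ⊗ A` of left multiplication `L_x : Q_R ⟶ Q_R` by an `R`-point
`x`: `r ⊗ f ↦ (r ⊗ 1) ((x ⊗ id) (∇ f))`. -/
def leftMul (x : Q.coord →ₐ[k] R) : R ⊗[k] Q.coord →ₐ[R] R ⊗[k] Q.coord :=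
  Algebra.TensorProduct.lift (Algebra.ofId R (R ⊗[k] Q.coord))
    ((Algebra.TensorProduct.map x (AlgHom.id k Q.coord)).comp Q.nabla)
    fun _ _ => Commute.all _ _

/-- The canonical map from `R ⊗ 𝔮` to linear forms on `R ⊗ A`,
`r ⊗ D ↦ (s ⊗ f ↦ r s D(f))`. -/
def tangentBase : R ⊗[k] Q.tangent →ₗ[R] (R ⊗[k] Q.coord →ₗ[R] R) :=
  LinearMap.liftBaseChange R
    { toFun := fun D => LinearMap.liftBaseChange R (Algebra.linearMap k R ∘ₗ D.1)
      map_add' := fun D E => by ext; simp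
      map_smul' := fun c D => by ext; simp [Algebra.smul_def] }

/-- `Ad : Q ⟶ GL(𝔮)` is the adjoint representation: `Ad_x = (dL_x)_e`, that is, under
`R ⊗ 𝔮 = Der_R(R ⊗ A, R)`, an `R`-point `x` acts by `E ↦ E ∘ L_x^♯`. -/
def IsAdjointRep (Ad : MorToGL (k := k) Q.coord Q.tangent) : Prop :=
  ∀ (R : Type u) [CommRing R] [Algebra k R] (x : Q.coord →ₐ[k] R) (t : R ⊗[k] Q.tangent),
    Q.tangentBase R (Ad.app R x t) = Q.tangentBase R t ∘ₗ (Q.leftMul R x).toLinearMap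

end AffRack

end AdjointRepresentation

section Groups

variable {k : Type u} [Field k]

/-- The conjugation quandle scheme `Conj(G)` of an affine algebraic group `G`. -/
def conjRack (G : Over (Spec (.of k))) [GrpObj G] [hG : IsAffine G.left]
    [hG' : LocallyOfFiniteType G.hom] : AffRack k :=
  ⟨conj G, hG, hG'⟩

/-- The Lie algebra of an affine algebraic group `G` with coordinate ring `A`: the left-invariant
derivations `T` of `A`, `Δ ∘ T = (id ⊗ T) ∘ Δ`, with the commutator bracket. -/
def lieAlg (G : Over (Spec (.of k))) [GrpObj G] [IsAffine G.left] :
    LieSubalgebra k (Derivation k (Coord G) (Coord G)) where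
  carrier := {T | ∀ f, comorphism μ[G] (T f) =
    (T : Coord G →ₗ[k] Coord G).lTensor (Coord G) (comorphism μ[G] f)}
  add_mem' := by
    intro S T hS hT f
    simp [hS f, hT f, LinearMap.lTensor_add]
  zero_mem' := by intro f; simp
  smul_mem' := by
    intro c T hT f
    simp [hT f, LinearMap.lTensor_smul]
  lie_mem' := by
    intro S T hS hT f
    have h : ((⁅S, T⁆ : Derivation k (Coord G) (Coord G)) : Coord G →ₗ[k] Coord G) =
        (S : Coord G →ₗ[k] Coord G) ∘ₗ (T : Coord G →ₗ[k] Coord G) -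
        (T : Coord G →ₗ[k] Coord G) ∘ₗ (S : Coord G →ₗ[k] Coord G) := by
      ext a
      exact Derivation.commutator_apply (D1 := S) (D2 := T) a
    rw [h, LinearMap.lTensor_sub, LinearMap.lTensor_comp, LinearMap.lTensor_comp]
    simp only [Derivation.commutator_apply, map_sub, LinearMap.sub_apply, LinearMap.comp_apply]
    rw [hS, hT, hT, hS]

end Groups

section LieRacks

variable {𝕜 : Type u} [RCLike 𝕜] {E : Type v} [NormedAddCommGroup E] [NormedSpace 𝕜 E]
  {M : Type w} [TopologicalSpace M] [ChartedSpace E M]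

variable (𝕜 E M) in
/-- A Lie rack structure on a smooth manifold `M` over `𝕜 = ℝ` or `ℂ`. -/
structure LieRack where
  op : M → M → M
  invOp : M → M → M
  unit : M
  op_invOp : ∀ x y, invOp (op x y) x = y
  invOp_op : ∀ x y, op x (invOp y x) = y
  left_distrib : ∀ x y z, op x (op y z) = op (op x y) (op x z)
  right_distrib : ∀ x y z, invOp (invOp x y) z = invOp (invOp x z) (invOp y z)
  fixing : ∀ x, op unit x = x
  fixed : ∀ x, op x unit = unit
  smooth_op : ContMDiff (𝓘(𝕜, E).prod 𝓘(𝕜, E)) 𝓘(𝕜, E) ∞ fun p : M × M => op p.1 p.2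
  smooth_invOp : ContMDiff (𝓘(𝕜, E).prod 𝓘(𝕜, E)) 𝓘(𝕜, E) ∞ fun p : M × M => invOp p.1 p.2

namespace LieRack

variable (L : LieRack 𝕜 E M)

/-- `Ad_x = (dL_x)_e`, an endomorphism of `T_e M` since `L_x(e) = e`. (Mathlib's tangent space at
any point of `M` is the model space `E`.) -/
def Ad (x : M) : E →L[𝕜] E := mfderiv 𝓘(𝕜, E) 𝓘(𝕜, E) (L.op x) L.unit

/-- `ad = (d Ad)_e : T_e M → End(T_e M)`. -/
def ad : E →L[𝕜] (E →L[𝕜] E) := mfderiv 𝓘(𝕜, E) 𝓘(𝕜, E →L[𝕜] E) L.Ad L.unit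

/-- The bracket `[X, Y] = ad_X(Y)` of the Leibniz algebra of a Lie rack, on `T_e M = E`. -/
def bracket (X Y : E) : E := L.ad X Y

end LieRack

/-- The manifold `M` with the Lie rack structure `L` is the Lie rack `Q(𝕜)` of rational points of
the affine algebraic rack `Q = Spec A`, through the bijection `j` from `M` to
`Q(𝕜) = Hom(A, 𝕜)`: the operation and the unit are those of `Q(𝕜)`, and a closed
embedding of `Q` into an affine space, given by generators `g₁, …, gₙ` of `A`, makes `M` an
embedded submanifold of `𝕜ⁿ`. -/
structure IsLieRackOfPoints (Q : AffRack 𝕜) (L : LieRack 𝕜 E M) (j : M ≃ (Q.coord →ₐ[𝕜] 𝕜)) :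
    Prop where
  op : ∀ x y, j (L.op x y) = (Algebra.TensorProduct.productMap (j x) (j y)).comp Q.nabla
  unit : j L.unit = Q.counit
  embedded : ∃ (n : ℕ) (g : Fin n → Q.coord), Algebra.adjoin 𝕜 (Set.range g) = ⊤ ∧
    Manifold.IsSmoothEmbedding 𝓘(𝕜, E) 𝓘(𝕜, Fin n → 𝕜) ∞ fun m i => j m (g i)

end LieRacks

end AlgRack

end

open AlgRack CategoryTheory AlgebraicGeometry
open scoped TensorProduct Manifold ContDiff MonObj

universe u v w

/-! Everything is computed on points. By the Yoneda lemma the rack axioms of `Q = Spec A` are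
identities between the operations `pointOp` on `Hom(A, R)`. Evaluated at the coordinate points of `A
⊗ A` and `A ⊗ (A ⊗ A)`, they become identities for `∇`; linear forms applied to these give the
infinitesimal statements. From `e ▷ x = x` comes `(ε ⊗ E) ∘ ∇ = E`, and from `x ▷ e = e` comes `(D ⊗
ε) ∘ ∇ = 0`. Together they make `(D ⊗ E) ∘ ∇` a point derivation (`convolve_mem_pointDer`). Apply `X
⊗ Y ⊗ Z` to self-distributivity: `x` occurs twice on the right, so the product rule for `X` yields
the two terms of the Leibniz identity (`convolve_leibniz`).

Since `A` is finitely generated, `R ⊗ 𝔮` is all of `Der_R(R ⊗ A, R)` (`range_tangentBase`), so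
composition with the automorphism `L_x^♯` defines `Ad_x` on `R ⊗ 𝔮`. At `x = ε + δD` its `δ`-part is
`(D ⊗ E) ∘ ∇` (`adjointRep_dualPoint`). For a group, the identity `(g h g⁻¹) g = g h` turns the
conjugation bracket into the commutator (`convolve_conj`), and `D ↦ (id ⊗ D) ∘ Δ` inverts `T ↦ ε ∘
T`.

On a Lie rack of points, `f (x ▷ y)` is a finite sum of products `a(x) b(y)`. Differentiating in `y`
and then in `x` at the unit gives `(D ⊗ E) (∇ f)`, so `θ` preserves brackets. It is injective
because an embedding is an immersion. At a smooth point, the implicit function theorem applied to a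
standard smooth presentation gives a curve of rational points with any prescribed velocity in `𝔮`
(`exists_curve_of_isSmoothAt`). This curve lifts smoothly to the embedded manifold, so `θ` is
surjective. -/

namespace AlgRack

open MonoidalCategory CartesianMonoidalCategory

noncomputable section

/-! ### Points of affine schemes as algebra homomorphisms -/

section Points

variable {k : Type u} [Field k]

theorem sharp_comp {X Y Z : Over (Spec (.of k))} (φ : X ⟶ Y) (ψ : Y ⟶ Z) :
    sharp (φ ≫ ψ) = (sharp φ).comp (sharp ψ) := by
  apply AlgHom.ext
  intro f
  change (φ ≫ ψ).left.appTop.hom f = φ.left.appTop.hom (ψ.left.appTop.hom f)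
  rw [Over.comp_left, Scheme.Hom.comp_appTop]
  rfl

theorem sharp_id (X : Over (Spec (.of k))) : sharp (𝟙 X) = AlgHom.id k _ := by
  apply AlgHom.ext
  intro f
  change (𝟙 X : X ⟶ X).left.appTop.hom f = f
  rw [Over.id_left, Scheme.Hom.id_appTop]
  rfl

/-- The `k`-algebra homomorphism `𝒪(X) → R` of an `R`-point of a `k`-scheme `X`. -/
def pointHom {X : Over (Spec (.of k))} {R : Type u} [CommRing R] [Algebra k R]
    (φ : specOver k R ⟶ X) : Coord X →ₐ[k] R :=
  (coordSpec R).comp (sharp φ)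

/-- The `R`-point of an affine `k`-scheme `X` of a `k`-algebra homomorphism `𝒪(X) → R`. -/
def homPoint (X : Over (Spec (.of k))) [IsAffine X.left] {R : Type u} [CommRing R] [Algebra k R]
    (x : Coord X →ₐ[k] R) : specOver k R ⟶ X :=
  specOverMap x ≫ fromSpec X

theorem pointHom_comp {X Y : Over (Spec (.of k))} {R : Type u} [CommRing R] [Algebra k R]
    (φ : specOver k R ⟶ X) (m : X ⟶ Y) : pointHom (φ ≫ m) = (pointHom φ).comp (sharp m) := by
  rw [pointHom, pointHom, sharp_comp, AlgHom.comp_assoc]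

theorem coordSpec_comp_sharp_specOverMap {B B' : Type u} [CommRing B] [Algebra k B]
    [CommRing B'] [Algebra k B'] (f : B →ₐ[k] B') :
    (coordSpec B').comp (sharp (specOverMap f)) = f.comp (coordSpec B) := by
  apply AlgHom.ext
  intro b
  exact congr(($(Scheme.ΓSpecIso_naturality (CommRingCat.ofHom f.toRingHom))).hom b)

theorem pointHom_specOverMap_comp {X : Over (Spec (.of k))} {R S : Type u} [CommRing R]
    [Algebra k R] [CommRing S] [Algebra k S] (g : R →ₐ[k] S) (φ : specOver k R ⟶ X) :
    pointHom (specOverMap g ≫ φ) = g.comp (pointHom φ) := by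
  rw [pointHom, sharp_comp, ← AlgHom.comp_assoc, coordSpec_comp_sharp_specOverMap,
    AlgHom.comp_assoc]
  rfl

theorem pointHom_fromSpec (X : Over (Spec (.of k))) [IsAffine X.left] :
    pointHom (fromSpec X) = AlgHom.id k _ := by
  apply AlgHom.ext
  intro f
  have h : X.left.isoSpec.inv.appTop ≫ (Scheme.ΓSpecIso Γ(X.left, ⊤)).hom = 𝟙 _ := by
    have h1 : X.left.isoSpec.hom.appTop = (Scheme.ΓSpecIso Γ(X.left, ⊤)).hom :=
      Scheme.toSpecΓ_appTop _
    rw [← h1, ← Scheme.Hom.comp_appTop, Iso.hom_inv_id, Scheme.Hom.id_appTop]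
  exact congr(($h).hom f)

theorem pointHom_homPoint {X : Over (Spec (.of k))} [IsAffine X.left] {R : Type u} [CommRing R]
    [Algebra k R] (x : Coord X →ₐ[k] R) : pointHom (homPoint X x) = x := by
  rw [homPoint, pointHom_specOverMap_comp, pointHom_fromSpec, AlgHom.comp_id]

theorem homPoint_pointHom {X : Over (Spec (.of k))} [IsAffine X.left] {R : Type u} [CommRing R]
    [Algebra k R] (φ : specOver k R ⟶ X) : homPoint X (pointHom φ) = φ := by
  apply Over.OverMorphism.ext
  have h (ψ : Spec (.of R) ⟶ X.left) :
      Spec.map (ψ.appTop ≫ (Scheme.ΓSpecIso (.of R)).hom) ≫ X.left.isoSpec.inv = ψ := by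
    rw [Spec.map_comp, Category.assoc, Scheme.isoSpec_inv_naturality, ← Category.assoc,
      Scheme.isoSpec_Spec_inv, ← Spec.map_comp, Iso.inv_hom_id, Spec.map_id, Category.id_comp]
  exact h φ.left

theorem pointHom_injective {X : Over (Spec (.of k))} [IsAffine X.left] {R : Type u} [CommRing R]
    [Algebra k R] : Function.Injective (pointHom : (specOver k R ⟶ X) → (Coord X →ₐ[k] R)) :=
  Function.LeftInverse.injective homPoint_pointHom

theorem specOverMap_comp_homPoint {X : Over (Spec (.of k))} [IsAffine X.left] {R S : Type u}
    [CommRing R] [Algebra k R] [CommRing S] [Algebra k S] (g : R →ₐ[k] S)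
    (x : Coord X →ₐ[k] R) : specOverMap g ≫ homPoint X x = homPoint X (g.comp x) := by
  apply pointHom_injective
  rw [pointHom_specOverMap_comp, pointHom_homPoint, pointHom_homPoint]

/-- The comorphism is the value of `m` at the universal pair of points over `A ⊗ A`; every other
pair is a base change of that one. -/
theorem productMap_comp_comorphism {X : Over (Spec (.of k))} [IsAffine X.left] {R : Type u}
    [CommRing R] [Algebra k R] (m : X ⊗ X ⟶ X) (x y : Coord X →ₐ[k] R) :
    (Algebra.TensorProduct.productMap x y).comp (comorphism m) =
      pointHom (lift (homPoint X x) (homPoint X y) ≫ m) := by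
  have h : comorphism m = pointHom
      (lift (homPoint X Algebra.TensorProduct.includeLeft)
        (homPoint X Algebra.TensorProduct.includeRight) ≫ m) := rfl
  rw [h, ← pointHom_specOverMap_comp, ← Category.assoc, comp_lift, specOverMap_comp_homPoint,
    specOverMap_comp_homPoint, Algebra.TensorProduct.productMap_left,
    Algebra.TensorProduct.productMap_right]

/-- The operation on `R`-points of an affine scheme with a binary operation, in terms of the
comorphism. -/
def pointOp {A R : Type*} [CommRing A] [Algebra k A] [CommRing R] [Algebra k R]
    (c : A →ₐ[k] A ⊗[k] A) (x y : A →ₐ[k] R) : A →ₐ[k] R :=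
  (Algebra.TensorProduct.productMap x y).comp c

theorem pointOp_pointHom {X : Over (Spec (.of k))} [IsAffine X.left] {R : Type u}
    [CommRing R] [Algebra k R] (m : X ⊗ X ⟶ X) (φ ψ : specOver k R ⟶ X) :
    pointOp (comorphism m) (pointHom φ) (pointHom ψ) = pointHom (lift φ ψ ≫ m) := by
  rw [pointOp, productMap_comp_comorphism, homPoint_pointHom, homPoint_pointHom]

/-- The constant `R`-point of a rational point. -/
def constPoint {A : Type*} [CommRing A] [Algebra k A] (ε : A →ₐ[k] k) (R : Type*) [CommRing R]
    [Algebra k R] : A →ₐ[k] R :=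
  (Algebra.ofId k R).comp ε

theorem pointHom_toUnit_comp {X : Over (Spec (.of k))} {R : Type u}
    [CommRing R] [Algebra k R] (e : 𝟙_ (Over (Spec (.of k))) ⟶ X) :
    pointHom (toUnit (specOver k R) ≫ e) = constPoint (evalAt e) R := by
  have h : toUnit (specOver k R) = specOverMap (Algebra.ofId k R) ≫ toUnit (specOver k k) :=
    toUnit_unique _ _
  rw [h, Category.assoc, pointHom_specOverMap_comp]
  rfl

theorem finiteType_coord (X : Over (Spec (.of k))) [IsAffine X.left]
    [h : LocallyOfFiniteType X.hom] : Algebra.FiniteType k (Coord X) := by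
  have : IsAffine ((Functor.fromPUnit (Spec (.of k))).obj X.right) :=
    inferInstanceAs (IsAffine (Spec (.of k)))
  have h1 : X.hom.appTop.hom.FiniteType :=
    (HasRingHomProperty.iff_of_isAffine (P := @LocallyOfFiniteType)).mp h
  have h2 : ((Scheme.ΓSpecIso (.of k)).inv).hom.FiniteType :=
    RingHom.FiniteType.of_surjective _
      (ConcreteCategory.bijective_of_isIso (Scheme.ΓSpecIso (.of k)).inv).2
  exact h1.comp h2

end Points

/-! ### Naturality of operations on points -/

section PointOperations

variable {k : Type u} [Field k] {A : Type v} [CommRing A] [Algebra k A]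

theorem comp_pointOp {R S : Type*} [CommRing R] [Algebra k R] [CommRing S] [Algebra k S]
    (g : R →ₐ[k] S) (c : A →ₐ[k] A ⊗[k] A) (x y : A →ₐ[k] R) :
    g.comp (pointOp c x y) = pointOp c (g.comp x) (g.comp y) := by
  rw [pointOp, pointOp, ← AlgHom.comp_assoc]
  congr 1
  ext <;> simp

/-- The Yoneda step: an identity that holds for all points can be read off as an identity for `c` at
the universal pair. -/
theorem pointOp_include (c : A →ₐ[k] A ⊗[k] A) :
    pointOp c Algebra.TensorProduct.includeLeft Algebra.TensorProduct.includeRight = c := by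
  have h : Algebra.TensorProduct.productMap (Algebra.TensorProduct.includeLeft)
      (Algebra.TensorProduct.includeRight) = AlgHom.id k (A ⊗[k] A) := by
    ext <;> simp
  rw [pointOp, h, AlgHom.id_comp]

theorem constPoint_apply (R : Type*) [CommRing R] [Algebra k R] (ε : A →ₐ[k] k) (f : A) :
    constPoint ε R f = algebraMap k R (ε f) := rfl

end PointOperations

/-! ### Convolution of point derivations and the Leibniz identity -/

section TensorForms

variable {k : Type u} [Field k] {A B : Type v} [CommRing A] [Algebra k A] [CommRing B]
  [Algebra k B]

/-- The linear form `a ⊗ b ↦ D a * E b`. -/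
def tensorForm (D : A →ₗ[k] k) (E : B →ₗ[k] k) : A ⊗[k] B →ₗ[k] k :=
  LinearMap.mul' k k ∘ₗ TensorProduct.map D E

@[simp]
theorem tensorForm_tmul (D : A →ₗ[k] k) (E : B →ₗ[k] k) (a : A) (b : B) :
    tensorForm D E (a ⊗ₜ b) = D a * E b := by
  simp [tensorForm]

theorem convolve_apply (c : A →ₐ[k] A ⊗[k] A) (D E : A →ₗ[k] k) (f : A) :
    convolve c D E f = tensorForm D E (c f) := rfl

theorem pointDer_apply_one {R C : Type*} [CommRing R] [CommRing C] [Algebra R C] {ε : C →ₐ[R] R}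
    (D : pointDer ε) : D.1 1 = 0 := by
  simpa using D.2 1 1

theorem pointDer_apply_algebraMap {R C : Type*} [CommRing R] [CommRing C] [Algebra R C]
    {ε : C →ₐ[R] R} (D : pointDer ε) (r : R) : D.1 (algebraMap R C r) = 0 := by
  rw [Algebra.algebraMap_eq_smul_one, map_smul, pointDer_apply_one, smul_zero]

/-- The product rule in each factor. Each of the two mixed terms contains a factor `D ⊗ ε`, which
vanishes after `∇` when `x ▷ e = e`. -/
theorem tensorForm_mul (ε : A →ₐ[k] k) (D E : pointDer ε) (s t : A ⊗[k] A) :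
    tensorForm D.1 E.1 (s * t) =
      tensorForm D.1 E.1 s * tensorForm ε.toLinearMap ε.toLinearMap t +
      tensorForm D.1 ε.toLinearMap s * tensorForm ε.toLinearMap E.1 t +
      tensorForm ε.toLinearMap E.1 s * tensorForm D.1 ε.toLinearMap t +
      tensorForm ε.toLinearMap ε.toLinearMap s * tensorForm D.1 E.1 t := by
  induction s using TensorProduct.induction_on with
  | zero => simp
  | add s₁ s₂ h₁ h₂ => simp only [add_mul, map_add, h₁, h₂]; ring
  | tmul a b =>
    induction t using TensorProduct.induction_on with
    | zero => simp
    | add t₁ t₂ h₁ h₂ => simp only [mul_add, map_add, h₁, h₂]; ring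
    | tmul a' b' =>
      simp only [Algebra.TensorProduct.tmul_mul_tmul, tensorForm_tmul, D.2 a a', E.2 b b',
        AlgHom.toLinearMap_apply]
      ring

variable {c : A →ₐ[k] A ⊗[k] A} {ε : A →ₐ[k] k}

theorem convolve_counit_left
    (h : pointOp c (constPoint ε A) (AlgHom.id k A) = AlgHom.id k A) (E : A →ₗ[k] k) :
    convolve c ε.toLinearMap E = E := by
  ext f
  rw [convolve_apply]
  conv_rhs => rw [← AlgHom.id_apply (R := k) f, ← h, pointOp, AlgHom.comp_apply]
  induction c f using TensorProduct.induction_on with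
  | zero => simp
  | add s₁ s₂ h₁ h₂ => simp only [map_add, h₁, h₂]
  | tmul a b => simp [constPoint_apply, ← Algebra.smul_def]

/-- A right unit law, which comultiplications satisfy; for the rack operation
`convolve_counit_of_fixed` takes its place. -/
theorem convolve_counit_right
    (h : pointOp c (AlgHom.id k A) (constPoint ε A) = AlgHom.id k A) (D : A →ₗ[k] k) :
    convolve c D ε.toLinearMap = D := by
  ext f
  rw [convolve_apply]
  conv_rhs => rw [← AlgHom.id_apply (R := k) f, ← h, pointOp, AlgHom.comp_apply]
  induction c f using TensorProduct.induction_on with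
  | zero => simp
  | add s₁ s₂ h₁ h₂ => simp only [map_add, h₁, h₂]
  | tmul a b =>
    have h : a * algebraMap k A (ε b) = ε b • a := by rw [mul_comm, Algebra.smul_def]
    simp [constPoint_apply, h, mul_comm]

/-- The map `x ↦ x ▷ e` is constant, so its derivative vanishes: a point derivation kills constants.
-/
theorem convolve_counit_of_fixed
    (h : pointOp c (AlgHom.id k A) (constPoint ε A) = constPoint ε A) (D : pointDer ε) :
    convolve c D.1 ε.toLinearMap = 0 := by
  ext f
  rw [convolve_apply, LinearMap.zero_apply, ← pointDer_apply_algebraMap D (ε f),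
    ← constPoint_apply, ← h, pointOp, AlgHom.comp_apply]
  induction c f using TensorProduct.induction_on with
  | zero => simp
  | add s₁ s₂ h₁ h₂ => simp only [map_add, h₁, h₂]
  | tmul a b =>
    have h : a * algebraMap k A (ε b) = ε b • a := by rw [mul_comm, Algebra.smul_def]
    simp [constPoint_apply, h, mul_comm]

theorem tensorForm_counit_comp
    (h : pointOp c (constPoint ε A) (AlgHom.id k A) = AlgHom.id k A) (f : A) :
    tensorForm ε.toLinearMap ε.toLinearMap (c f) = ε f := by
  rw [← convolve_apply, convolve_counit_left h]
  rfl

/-- `(D ⊗ E) ∘ ∇` is a point derivation if `e ▷ x = x` and `x ▷ e = e`. -/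
theorem convolve_mem_pointDer
    (h₁ : pointOp c (constPoint ε A) (AlgHom.id k A) = AlgHom.id k A)
    (h₂ : pointOp c (AlgHom.id k A) (constPoint ε A) = constPoint ε A) (D E : pointDer ε) :
    convolve c D.1 E.1 ∈ pointDer ε := by
  intro f g
  have h (f : A) : tensorForm D.1 ε.toLinearMap (c f) = 0 :=
    congr($(convolve_counit_of_fixed h₂ D) f)
  rw [convolve_apply, map_mul, tensorForm_mul, h, h, tensorForm_counit_comp h₁,
    tensorForm_counit_comp h₁, convolve_apply, convolve_apply]
  ring

theorem convolve_add_left (c : A →ₐ[k] A ⊗[k] A) (D D' E : A →ₗ[k] k) :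
    convolve c (D + D') E = convolve c D E + convolve c D' E := by
  ext; simp [convolve, TensorProduct.map_add_left]

theorem convolve_add_right (c : A →ₐ[k] A ⊗[k] A) (D E E' : A →ₗ[k] k) :
    convolve c D (E + E') = convolve c D E + convolve c D E' := by
  ext; simp [convolve, TensorProduct.map_add_right]

theorem convolve_smul_left (c : A →ₐ[k] A ⊗[k] A) (r : k) (D E : A →ₗ[k] k) :
    convolve c (r • D) E = r • convolve c D E := by
  ext; simp [convolve, TensorProduct.map_smul_left]

theorem convolve_smul_right (c : A →ₐ[k] A ⊗[k] A) (r : k) (D E : A →ₗ[k] k) :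
    convolve c D (r • E) = r • convolve c D E := by
  ext; simp [convolve, TensorProduct.map_smul_right]

/-- The bracket `[D, E] = (D ⊗ E) ∘ ∇` on point derivations. -/
def derBracket (h₁ : pointOp c (constPoint ε A) (AlgHom.id k A) = AlgHom.id k A)
    (h₂ : pointOp c (AlgHom.id k A) (constPoint ε A) = constPoint ε A) :
    pointDer ε →ₗ[k] pointDer ε →ₗ[k] pointDer ε :=
  LinearMap.mk₂ k (fun D E => ⟨convolve c D.1 E.1, convolve_mem_pointDer h₁ h₂ D E⟩)
    (fun _ _ _ => Subtype.ext (convolve_add_left ..))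
    (fun _ _ _ => Subtype.ext (convolve_smul_left ..))
    (fun _ _ _ => Subtype.ext (convolve_add_right ..))
    (fun _ _ _ => Subtype.ext (convolve_smul_right ..))

variable (k A) in
/-- The first coordinate point of `A` with values in `A ⊗ (A ⊗ A)`. -/
def threePoint₁ : A →ₐ[k] A ⊗[k] (A ⊗[k] A) := Algebra.TensorProduct.includeLeft

variable (k A) in
/-- The second coordinate point of `A` with values in `A ⊗ (A ⊗ A)`. -/
def threePoint₂ : A →ₐ[k] A ⊗[k] (A ⊗[k] A) :=
  Algebra.TensorProduct.includeRight.comp Algebra.TensorProduct.includeLeft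

variable (k A) in
/-- The third coordinate point of `A` with values in `A ⊗ (A ⊗ A)`. -/
def threePoint₃ : A →ₐ[k] A ⊗[k] (A ⊗[k] A) :=
  Algebra.TensorProduct.includeRight.comp Algebra.TensorProduct.includeRight

theorem tensorForm_pointOp_nested (c : A →ₐ[k] A ⊗[k] A) (X Y Z : A →ₗ[k] k) (f : A) :
    tensorForm X (tensorForm Y Z)
      (pointOp c (threePoint₁ k A) (pointOp c (threePoint₂ k A) (threePoint₃ k A)) f) =
      convolve c X (convolve c Y Z) f := by
  have h : pointOp c (threePoint₂ k A) (threePoint₃ k A) =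
      Algebra.TensorProduct.includeRight.comp c := by
    rw [threePoint₂, threePoint₃, ← comp_pointOp, pointOp_include]
  rw [h, convolve_apply, pointOp, AlgHom.comp_apply]
  induction c f using TensorProduct.induction_on with
  | zero => simp
  | add s₁ s₂ h₁ h₂ => simp only [map_add, h₁, h₂]
  | tmul a b => simp [threePoint₁, convolve_apply]

/-- This treats a function of `(x, y)` times a function of `(x, z)`. Only the shared variable `x` is
differentiated by a product rule, and this is the source of the two terms in the Leibniz identity.
-/
theorem tensorForm_mul_three (D : pointDer ε) (Y Z : A →ₗ[k] k) (s t : A ⊗[k] A) :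
    tensorForm D.1 (tensorForm Y Z)
      (Algebra.TensorProduct.productMap (threePoint₁ k A) (threePoint₂ k A) s *
        Algebra.TensorProduct.productMap (threePoint₁ k A) (threePoint₃ k A) t) =
      tensorForm D.1 Y s * tensorForm ε.toLinearMap Z t +
        tensorForm ε.toLinearMap Y s * tensorForm D.1 Z t := by
  induction s using TensorProduct.induction_on with
  | zero => simp
  | add s₁ s₂ h₁ h₂ => simp only [add_mul, map_add, h₁, h₂]; ring
  | tmul a b =>
    induction t using TensorProduct.induction_on with
    | zero => simp
    | add t₁ t₂ h₁ h₂ => simp only [mul_add, map_add, h₁, h₂]; ring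
    | tmul a' b' =>
      simp [threePoint₁, threePoint₂, threePoint₃, D.2 a a']
      ring

/-- Self-distributivity implies the Leibniz identity. -/
theorem convolve_leibniz
    (h₁ : pointOp c (constPoint ε A) (AlgHom.id k A) = AlgHom.id k A)
    (h : pointOp c (threePoint₁ k A) (pointOp c (threePoint₂ k A) (threePoint₃ k A)) =
      pointOp c (pointOp c (threePoint₁ k A) (threePoint₂ k A))
        (pointOp c (threePoint₁ k A) (threePoint₃ k A))) (X : pointDer ε) (Y Z : A →ₗ[k] k) :
    convolve c X.1 (convolve c Y Z) =
      convolve c (convolve c X.1 Y) Z + convolve c Y (convolve c X.1 Z) := by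
  ext f
  rw [← tensorForm_pointOp_nested, h, LinearMap.add_apply, convolve_apply, convolve_apply,
    pointOp, AlgHom.comp_apply]
  induction c f using TensorProduct.induction_on with
  | zero => simp
  | add s₁ s₂ h₁ h₂ => simp only [map_add, h₁, h₂]; ring
  | tmul a b =>
    -- For a term `a ⊗ b` of `∇ f`, the right side is `a(x ▷ y) b(x ▷ z)`. In each of the two
    -- product-rule terms, the factor not differentiated in `x` is evaluated at `x = e`, where `e ▷
    -- y = y` simplifies it.
    have hl (E : A →ₗ[k] k) (f : A) : tensorForm ε.toLinearMap E (c f) = E f :=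
      congr($(convolve_counit_left h₁ E) f)
    rw [Algebra.TensorProduct.productMap_apply_tmul]
    simp only [pointOp, AlgHom.comp_apply, tensorForm_mul_three, hl, tensorForm_tmul,
      convolve_apply]

theorem convolve_comp {A' : Type v} [CommRing A'] [Algebra k A'] {c' : A' →ₐ[k] A' ⊗[k] A'}
    (φ : A →ₐ[k] A') (h : c'.comp φ = (Algebra.TensorProduct.map φ φ).comp c)
    (D E : A' →ₗ[k] k) :
    convolve c' D E ∘ₗ φ.toLinearMap = convolve c (D ∘ₗ φ.toLinearMap) (E ∘ₗ φ.toLinearMap) := by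
  ext f
  have hf : c' (φ f) = Algebra.TensorProduct.map φ φ (c f) := congr($h f)
  rw [LinearMap.comp_apply, AlgHom.toLinearMap_apply, convolve_apply, convolve_apply, hf]
  induction c f using TensorProduct.induction_on with
  | zero => simp
  | add s₁ s₂ h₁ h₂ => simp only [map_add, h₁, h₂]
  | tmul a b => simp

/-- The map `D ↦ D ∘ φ` of point derivations. -/
def derMap {A' : Type v} [CommRing A'] [Algebra k A'] {ε' : A' →ₐ[k] k} (φ : A →ₐ[k] A')
    (h : ε'.comp φ = ε) : pointDer ε' →ₗ[k] pointDer ε where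
  toFun D := ⟨D.1 ∘ₗ φ.toLinearMap, fun f g => by
    simp [D.2 (φ f) (φ g), ← h]⟩
  map_add' _ _ := rfl
  map_smul' _ _ := rfl

end TensorForms

/-! ### Rack axioms on points, the bracket and its functoriality -/

namespace AffRack

variable {k : Type u} [Field k] (Q : AffRack k) {R : Type u} [CommRing R] [Algebra k R]

/-- As for the axioms below: the diagrammatic identity is precomposed with the morphisms that
represent the points. -/
theorem pointOp_counit_left (x : Q.coord →ₐ[k] R) :
    pointOp Q.nabla (constPoint Q.counit R) x = x := by
  obtain ⟨φ, rfl⟩ : ∃ φ, pointHom φ = x := ⟨_, pointHom_homPoint x⟩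
  rw [counit, ← pointHom_toUnit_comp, nabla, pointOp_pointHom]
  have h := congr(φ ≫ $Q.obj.fixing)
  rw [← Category.assoc, comp_lift, ← Category.assoc, Category.comp_id, comp_toUnit] at h
  rw [h]

theorem pointOp_counit_right (x : Q.coord →ₐ[k] R) :
    pointOp Q.nabla x (constPoint Q.counit R) = constPoint Q.counit R := by
  obtain ⟨φ, rfl⟩ : ∃ φ, pointHom φ = x := ⟨_, pointHom_homPoint x⟩
  rw [counit, ← pointHom_toUnit_comp, nabla, pointOp_pointHom]
  have h := congr(φ ≫ $Q.obj.fixed)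
  rw [← Category.assoc, comp_lift, ← Category.assoc, Category.comp_id, comp_toUnit] at h
  rw [h]

theorem pointOp_left_distrib (x y z : Q.coord →ₐ[k] R) :
    pointOp Q.nabla x (pointOp Q.nabla y z) =
      pointOp Q.nabla (pointOp Q.nabla x y) (pointOp Q.nabla x z) := by
  obtain ⟨φ, rfl⟩ : ∃ φ, pointHom φ = x := ⟨_, pointHom_homPoint x⟩
  obtain ⟨ψ, rfl⟩ : ∃ φ, pointHom φ = y := ⟨_, pointHom_homPoint y⟩
  obtain ⟨χ, rfl⟩ : ∃ φ, pointHom φ = z := ⟨_, pointHom_homPoint z⟩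
  simp only [nabla, pointOp_pointHom]
  simpa [comp_lift_assoc] using congr(pointHom (lift φ (lift ψ χ) ≫ $Q.obj.left_distrib))

/-- The comorphism of `▷⁻¹`. -/
def conabla : Q.coord →ₐ[k] Q.coord ⊗[k] Q.coord := comorphism Q.obj.invOp

/-- With `pointOp_nabla_conabla`, this is what makes each `L_x^♯` an automorphism. -/
theorem pointOp_conabla_nabla (x y : Q.coord →ₐ[k] R) :
    pointOp Q.conabla (pointOp Q.nabla x y) x = y := by
  obtain ⟨φ, rfl⟩ : ∃ φ, pointHom φ = x := ⟨_, pointHom_homPoint x⟩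
  obtain ⟨ψ, rfl⟩ : ∃ φ, pointHom φ = y := ⟨_, pointHom_homPoint y⟩
  simp only [nabla, conabla, pointOp_pointHom]
  simpa [comp_lift_assoc] using congr(pointHom (lift φ ψ ≫ $Q.obj.op_invOp ≫ snd _ _))

theorem pointOp_nabla_conabla (x y : Q.coord →ₐ[k] R) :
    pointOp Q.nabla x (pointOp Q.conabla y x) = y := by
  obtain ⟨φ, rfl⟩ : ∃ φ, pointHom φ = x := ⟨_, pointHom_homPoint x⟩
  obtain ⟨ψ, rfl⟩ : ∃ φ, pointHom φ = y := ⟨_, pointHom_homPoint y⟩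
  simp only [nabla, conabla, pointOp_pointHom]
  simpa [comp_lift_assoc] using congr(pointHom (lift ψ φ ≫ $Q.obj.invOp_op ≫ fst _ _))

/-- The bracket of the Leibniz algebra of an affine algebraic rack. -/
def bracket : Q.tangent →ₗ[k] Q.tangent →ₗ[k] Q.tangent :=
  derBracket (Q.pointOp_counit_left _) (Q.pointOp_counit_right _)

theorem bracket_val (D E : Q.tangent) : (Q.bracket D E).1 = convolve Q.nabla D.1 E.1 := rfl

theorem isLeibnizBracket_bracket :
    IsLeibnizBracket (k := k) (V := Q.tangent) Q.bracket := fun X Y Z =>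
  Subtype.ext (convolve_leibniz (Q.pointOp_counit_left _) (Q.pointOp_left_distrib _ _ _) X Y.1 Z.1)

variable {Q} {P : AffRack k} (φ : Q ⟶ P)

theorem comp_comap_pointOp (x y : Q.coord →ₐ[k] R) :
    (pointOp Q.nabla x y).comp (comap φ) =
      pointOp P.nabla (x.comp (comap φ)) (y.comp (comap φ)) := by
  obtain ⟨χ, rfl⟩ : ∃ φ, pointHom φ = x := ⟨_, pointHom_homPoint x⟩
  obtain ⟨ψ, rfl⟩ : ∃ φ, pointHom φ = y := ⟨_, pointHom_homPoint y⟩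
  simp only [nabla, comap, pointOp_pointHom, ← pointHom_comp]
  simpa using congr(pointHom (lift χ ψ ≫ $φ.hom.op_hom))

theorem counit_comp_comap : Q.counit.comp (comap φ) = P.counit := by
  have h : Q.obj.unit ≫ φ.hom.hom = P.obj.unit := φ.hom.unit_hom
  change (pointHom _).comp (sharp _) = pointHom _
  rw [← pointHom_comp, Category.assoc, h]

theorem nabla_comp_comap :
    Q.nabla.comp (comap φ) = (Algebra.TensorProduct.map (comap φ) (comap φ)).comp P.nabla := by
  rw [← pointOp_include Q.nabla, comp_comap_pointOp, ← pointOp_include P.nabla, comp_pointOp,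
    pointOp_include]
  congr 1 <;> ext <;> simp

/-- The derivative at the unit of a morphism of affine algebraic racks. -/
def tangentMap : Q.tangent →ₗ[k] P.tangent := derMap (comap φ) (counit_comp_comap φ)

theorem tangentMap_bracket (D E : Q.tangent) :
    tangentMap φ (Q.bracket D E) = P.bracket (tangentMap φ D) (tangentMap φ E) :=
  Subtype.ext (convolve_comp (comap φ) (nabla_comp_comap φ) D.1 E.1)

theorem tangentMap_id : tangentMap (𝟙 Q) = LinearMap.id := by
  apply LinearMap.ext
  intro D
  apply Subtype.ext
  change D.1 ∘ₗ (sharp (𝟙 Q.obj.X)).toLinearMap = D.1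
  rw [sharp_id]
  rfl

theorem tangentMap_comp {S : AffRack k} (ψ : P ⟶ S) :
    tangentMap (φ ≫ ψ) = tangentMap ψ ∘ₗ tangentMap φ := by
  apply LinearMap.ext
  intro D
  apply Subtype.ext
  change D.1 ∘ₗ (sharp (φ.hom.hom ≫ ψ.hom.hom)).toLinearMap = _
  rw [sharp_comp]
  rfl

variable (k) in
/-- The functor from affine algebraic racks to Leibniz algebras. -/
def tangentFunctor : AffRack k ⥤ LeibAlg k where
  obj Q := LeibAlg.of (k := k) (V := Q.tangent) Q.bracket Q.isLeibnizBracket_bracket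
  map {Q R} φ := LeibAlg.ofHom (k := k) (V := Q.tangent) (W := R.tangent) (tangentMap φ)
    (tangentMap_bracket φ)
  map_id Q := LeibHom.ext (tangentMap_id (Q := Q))
  map_comp φ ψ := LeibHom.ext (tangentMap_comp φ ψ)

end AffRack

/-! ### Point derivations are determined by generators -/

section FiniteGeneration

variable {k : Type u} [Field k] {A : Type v} [CommRing A] [Algebra k A] {ε : A →ₐ[k] k}

/-- A point derivation with values in a module takes values in any subspace that contains its
values on generators. -/
theorem derivation_mem_of_adjoin {N : Type*} [AddCommGroup N] [Module k N] (F : A →ₗ[k] N)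
    (hF : ∀ f g, F (f * g) = ε g • F f + ε f • F g) {s : Set A} (hs : Algebra.adjoin k s = ⊤)
    (W : Submodule k N) (hW : ∀ a ∈ s, F a ∈ W) (f : A) : F f ∈ W := by
  have h1 : F 1 = 0 := by simpa using hF 1 1
  have hf : f ∈ Algebra.adjoin k s := hs ▸ Algebra.mem_top
  induction hf using Algebra.adjoin_induction with
  | mem x hx => exact hW x hx
  | algebraMap r =>
    rw [Algebra.algebraMap_eq_smul_one, map_smul, h1, smul_zero]
    exact W.zero_mem
  | add x y _ _ hx hy => rw [map_add]; exact W.add_mem hx hy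
  | mul x y _ _ hx hy => rw [hF]; exact W.add_mem (W.smul_mem _ hx) (W.smul_mem _ hy)

/-- The values of a point derivation on a set of functions. -/
def derEval (ε : A →ₐ[k] k) (s : Set A) : pointDer ε →ₗ[k] (s → k) where
  toFun D a := D.1 a
  map_add' _ _ := rfl
  map_smul' _ _ := rfl

theorem derEval_injective {s : Set A} (hs : Algebra.adjoin k s = ⊤) :
    Function.Injective (derEval ε s) := by
  rw [injective_iff_map_eq_zero]
  intro D hD
  apply Subtype.ext
  ext f
  refine derivation_mem_of_adjoin (ε := ε) D.1 (fun f g => ?_) hs ⊥ (fun a ha => ?_) f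
  · rw [D.2 f g, smul_eq_mul, smul_eq_mul, mul_comm (D.1 f)]
  · exact congr_fun hD ⟨a, ha⟩

end FiniteGeneration

/-! ### Transport along automorphisms that fix the point -/

section TransportOfDerivations

variable {R B : Type*} [CommRing R] [CommRing B] [Algebra R B]

/-- The automorphism `D ↦ D ∘ σ` of point derivations given by an automorphism `σ` that
fixes the point. -/
def derCongr {ε : B →ₐ[R] R} (σ : B ≃ₐ[R] B) (h : ε.comp σ.toAlgHom = ε) :
    pointDer ε ≃ₗ[R] pointDer ε where
  toFun D := ⟨D.1 ∘ₗ σ.toLinearMap, fun f g => by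
    have (f : B) : ε (σ f) = ε f := congr($h f)
    simp [D.2 (σ f) (σ g), this]⟩
  invFun D := ⟨D.1 ∘ₗ σ.symm.toLinearMap, fun f g => by
    have (f : B) : ε (σ.symm f) = ε f := by
      conv_rhs => rw [← σ.apply_symm_apply f]
      exact congr($h.symm (σ.symm f))
    simp [D.2 (σ.symm f) (σ.symm g), this]⟩
  map_add' _ _ := rfl
  map_smul' _ _ := rfl
  left_inv D := by apply Subtype.ext; ext; simp
  right_inv D := by apply Subtype.ext; ext; simp

end TransportOfDerivations

/-! ### Base change of the tangent space and the adjoint representation -/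

namespace AffRack

variable {k : Type u} [Field k] (Q : AffRack k)

instance : Algebra.FiniteType k Q.coord :=
  have := Q.property.2
  finiteType_coord Q.obj.X

variable (R : Type u) [CommRing R] [Algebra k R]

theorem tangentBase_tmul (r s : R) (D : Q.tangent) (f : Q.coord) :
    Q.tangentBase R (r ⊗ₜ D) (s ⊗ₜ f) = r * s * algebraMap k R (D.1 f) := by
  simp [tangentBase, mul_assoc]

theorem counitBase_tmul (r : R) (f : Q.coord) :
    Q.counitBase R (r ⊗ₜ f) = r * algebraMap k R (Q.counit f) := by
  simp [counitBase, Algebra.ofId_apply]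

/-- Evaluation on a finite generating set `s` embeds `𝔮` into `k^s`. Tensoring with the flat module
`R` keeps this injective, and finiteness of `s` identifies `R ⊗ k^s` with `R^s`. -/
theorem tangentBase_injective : Function.Injective (Q.tangentBase R) := by
  classical
  obtain ⟨s, hs⟩ := (inferInstance : Algebra.FiniteType k Q.coord).out
  have hinj := Module.Flat.lTensor_preserves_injective_linearMap (M := R) (derEval Q.counit s)
    (derEval_injective hs)
  rw [injective_iff_map_eq_zero] at hinj ⊢
  intro t ht
  refine hinj t ((TensorProduct.piScalarRight k k R s).injective ?_)
  rw [map_zero]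
  ext a
  have h (t : R ⊗[k] Q.tangent) :
      TensorProduct.piScalarRight k k R s ((derEval Q.counit s).lTensor R t) a =
        Q.tangentBase R t (1 ⊗ₜ a.1) := by
    induction t using TensorProduct.induction_on with
    | zero => simp
    | add t₁ t₂ h₁ h₂ => simp only [map_add, Pi.add_apply, h₁, h₂, LinearMap.add_apply]
    | tmul r D =>
      rw [tangentBase_tmul]
      simp [derEval, Algebra.smul_def, mul_comm]
  rw [h, ht]
  rfl

theorem tangentBase_mem (t : R ⊗[k] Q.tangent) : Q.tangentBase R t ∈ pointDer (Q.counitBase R) := by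
  induction t using TensorProduct.induction_on with
  | zero => rw [map_zero]; exact Submodule.zero_mem _
  | add t₁ t₂ h₁ h₂ => rw [map_add]; exact Submodule.add_mem _ h₁ h₂
  | tmul r D =>
    intro s t
    induction s using TensorProduct.induction_on with
    | zero => simp
    | add s₁ s₂ h₁ h₂ => simp only [add_mul, map_add, h₁, h₂]; ring
    | tmul a b =>
      induction t using TensorProduct.induction_on with
      | zero => simp
      | add t₁ t₂ h₁ h₂ => simp only [mul_add, map_add, h₁, h₂]; ring
      | tmul a' b' =>
        simp only [Algebra.TensorProduct.tmul_mul_tmul, tangentBase_tmul, counitBase_tmul,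
          D.2 b b', map_add, map_mul]
        ring

/-- Restricted to `A`, the derivation takes values in the `k`-span `W` of its values on finitely
many generators. Its coordinates in a basis of `W` are elements of `𝔮`. -/
theorem exists_tangentBase_eq {F : R ⊗[k] Q.coord →ₗ[R] R} (hF : F ∈ pointDer (Q.counitBase R)) :
    ∃ t, Q.tangentBase R t = F := by
  obtain ⟨s, hs⟩ := (inferInstance : Algebra.FiniteType k Q.coord).out
  let F' : Q.coord →ₗ[k] R := F.restrictScalars k ∘ₗ
    (Algebra.TensorProduct.includeRight : Q.coord →ₐ[k] R ⊗[k] Q.coord).toLinearMap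
  have hF' (f g : Q.coord) : F' (f * g) = Q.counit g • F' f + Q.counit f • F' g := by
    have := hF (1 ⊗ₜ f) (1 ⊗ₜ g)
    rw [Algebra.TensorProduct.tmul_mul_tmul, mul_one, counitBase_tmul, counitBase_tmul, one_mul,
      one_mul, mul_comm (F _)] at this
    simpa [F', Algebra.smul_def] using this
  let W : Submodule k R := Submodule.span k (F' '' s)
  have hW (f : Q.coord) : F' f ∈ W := derivation_mem_of_adjoin F' hF' hs W
    (fun a ha => Submodule.subset_span ⟨a, ha, rfl⟩) f
  have : FiniteDimensional k W := FiniteDimensional.span_of_finite k (s.finite_toSet.image F')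
  let w := Module.finBasis k W
  let G : Q.coord →ₗ[k] W := F'.codRestrict W hW
  have hG (f g : Q.coord) : G (f * g) = Q.counit g • G f + Q.counit f • G g :=
    Subtype.ext (hF' f g)
  let D (i) : Q.tangent := ⟨w.coord i ∘ₗ G, fun f g => by
    simp only [LinearMap.comp_apply, hG, map_add, map_smul, smul_eq_mul]
    ring⟩
  -- The expansion of the values in the basis `w` is itself the preimage.
  refine ⟨∑ i, (w i : R) ⊗ₜ D i, ?_⟩
  ext f
  have h : F' f = ∑ i, w.repr (G f) i • (w i : R) := by
    have := congrArg W.subtype (w.sum_repr (G f))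
    rw [map_sum] at this
    exact this.symm
  have h' : F (1 ⊗ₜ f) = F' f := rfl
  simp only [TensorProduct.AlgebraTensorModule.curry_apply, TensorProduct.curry_apply, LinearMap.coe_restrictScalars]
  rw [h', h, map_sum, LinearMap.sum_apply]
  refine Finset.sum_congr rfl fun i _ => ?_
  rw [tangentBase_tmul, mul_one, mul_comm, ← Algebra.smul_def]
  rfl

theorem range_tangentBase : LinearMap.range (Q.tangentBase R) = pointDer (Q.counitBase R) := by
  ext F
  exact ⟨fun ⟨t, ht⟩ => ht ▸ Q.tangentBase_mem R t, fun h => Q.exists_tangentBase_eq R h⟩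

/-- `R ⊗ 𝔮` is the space of derivations of `R ⊗ A` at the unit. -/
def tangentBaseEquiv : R ⊗[k] Q.tangent ≃ₗ[R] pointDer (Q.counitBase R) :=
  (LinearEquiv.ofInjective (Q.tangentBase R) (Q.tangentBase_injective R)).trans
    (LinearEquiv.ofEq _ _ (Q.range_tangentBase R))

theorem tangentBaseEquiv_val (t : R ⊗[k] Q.tangent) :
    (Q.tangentBaseEquiv R t).1 = Q.tangentBase R t := rfl

variable {R}

theorem leftMul_one_tmul (x : Q.coord →ₐ[k] R) (f : Q.coord) :
    Q.leftMul R x (1 ⊗ₜ f) = Algebra.TensorProduct.map x (AlgHom.id k Q.coord) (Q.nabla f) := by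
  rw [leftMul, Algebra.TensorProduct.lift_tmul, map_one, one_mul]
  rfl

/-- The inverse of `L_x^♯`, given by `y ↦ y ▷⁻¹ x`. -/
def leftMulInv (x : Q.coord →ₐ[k] R) : R ⊗[k] Q.coord →ₐ[R] R ⊗[k] Q.coord :=
  Algebra.TensorProduct.lift (Algebra.ofId R (R ⊗[k] Q.coord))
    (pointOp Q.conabla Algebra.TensorProduct.includeRight
      (Algebra.TensorProduct.includeLeft.comp x))
    fun _ _ => Commute.all _ _

theorem restrictScalars_comp_includeLeft (σ : R ⊗[k] Q.coord →ₐ[R] R ⊗[k] Q.coord)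
    (x : Q.coord →ₐ[k] R) :
    (σ.restrictScalars k).comp (Algebra.TensorProduct.includeLeft.comp x) =
      Algebra.TensorProduct.includeLeft.comp x := by
  ext f
  exact σ.commutes (x f)

/-- On `A`, the map `L_x^♯` is the point `x ▷ y` for the universal point `y` of `Q_R`. Composites of
such maps can thus be computed by the rack axioms. -/
theorem leftMul_comp_includeRight (x : Q.coord →ₐ[k] R) :
    ((Q.leftMul R x).restrictScalars k).comp Algebra.TensorProduct.includeRight =
      pointOp Q.nabla (Algebra.TensorProduct.includeLeft.comp x)
        Algebra.TensorProduct.includeRight := by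
  ext f
  change Q.leftMul R x (1 ⊗ₜ f) = _
  rw [leftMul_one_tmul, pointOp, AlgHom.comp_apply]
  congr 1
  ext <;> simp

theorem leftMulInv_comp_includeRight (x : Q.coord →ₐ[k] R) :
    ((Q.leftMulInv x).restrictScalars k).comp Algebra.TensorProduct.includeRight =
      pointOp Q.conabla Algebra.TensorProduct.includeRight
        (Algebra.TensorProduct.includeLeft.comp x) := by
  ext f
  simp [leftMulInv]

theorem algHom_base_ext {C : Type*} [CommRing C] [Algebra k C] [Algebra R C] [IsScalarTower k R C]
    {σ τ : R ⊗[k] Q.coord →ₐ[R] C}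
    (h : (σ.restrictScalars k).comp Algebra.TensorProduct.includeRight =
      (τ.restrictScalars k).comp Algebra.TensorProduct.includeRight) : σ = τ :=
  Algebra.TensorProduct.ext (Subsingleton.elim _ _) h

theorem leftMul_comp_leftMulInv (x : Q.coord →ₐ[k] R) :
    (Q.leftMul R x).comp (Q.leftMulInv x) = AlgHom.id R _ := by
  apply Q.algHom_base_ext
  change ((Q.leftMul R x).restrictScalars k).comp
    (((Q.leftMulInv x).restrictScalars k).comp Algebra.TensorProduct.includeRight) = _
  rw [leftMulInv_comp_includeRight, comp_pointOp, leftMul_comp_includeRight,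
    restrictScalars_comp_includeLeft, pointOp_conabla_nabla]
  rfl

theorem leftMulInv_comp_leftMul (x : Q.coord →ₐ[k] R) :
    (Q.leftMulInv x).comp (Q.leftMul R x) = AlgHom.id R _ := by
  apply Q.algHom_base_ext
  change ((Q.leftMulInv x).restrictScalars k).comp
    (((Q.leftMul R x).restrictScalars k).comp Algebra.TensorProduct.includeRight) = _
  rw [leftMul_comp_includeRight, comp_pointOp, leftMulInv_comp_includeRight,
    restrictScalars_comp_includeLeft, pointOp_nabla_conabla]
  rfl

/-- `L_x^♯` as an automorphism. -/
def leftMulEquiv (x : Q.coord →ₐ[k] R) : R ⊗[k] Q.coord ≃ₐ[R] R ⊗[k] Q.coord :=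
  AlgEquiv.ofAlgHom (Q.leftMul R x) (Q.leftMulInv x) (Q.leftMul_comp_leftMulInv x)
    (Q.leftMulInv_comp_leftMul x)

/-- This is `x ▷ e = e`; it lets `L_x^♯` act on derivations at the unit. -/
theorem counitBase_comp_leftMul (x : Q.coord →ₐ[k] R) :
    (Q.counitBase R).comp (Q.leftMul R x) = Q.counitBase R := by
  apply Q.algHom_base_ext
  have h₁ : ((Q.counitBase R).restrictScalars k).comp
      (Algebra.TensorProduct.includeLeft.comp x) = x := by
    ext f
    exact (Q.counitBase R).commutes (x f)
  have h₂ : ((Q.counitBase R).restrictScalars k).comp Algebra.TensorProduct.includeRight =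
      constPoint Q.counit R := by
    ext f
    change Q.counitBase R (1 ⊗ₜ f) = _
    rw [counitBase_tmul, one_mul]
    rfl
  change ((Q.counitBase R).restrictScalars k).comp
    (((Q.leftMul R x).restrictScalars k).comp Algebra.TensorProduct.includeRight) = _
  rw [leftMul_comp_includeRight, comp_pointOp, h₁, h₂, pointOp_counit_right]

/-- `Ad_x = (dL_x)_e` on `R ⊗ 𝔮`. -/
def adPoint (x : Q.coord →ₐ[k] R) : R ⊗[k] Q.tangent ≃ₗ[R] R ⊗[k] Q.tangent :=
  ((Q.tangentBaseEquiv R).trans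
    (derCongr (Q.leftMulEquiv x) (Q.counitBase_comp_leftMul x))).trans (Q.tangentBaseEquiv R).symm

theorem tangentBase_adPoint (x : Q.coord →ₐ[k] R) (t : R ⊗[k] Q.tangent) :
    Q.tangentBase R (Q.adPoint x t) = Q.tangentBase R t ∘ₗ (Q.leftMul R x).toLinearMap := by
  rw [← tangentBaseEquiv_val, adPoint, LinearEquiv.trans_apply, LinearEquiv.apply_symm_apply]
  rfl

theorem tangentBase_adPoint_one_tmul (x : Q.coord →ₐ[k] R) (t : R ⊗[k] Q.tangent) (f : Q.coord) :
    Q.tangentBase R (Q.adPoint x t) (1 ⊗ₜ f) =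
      Q.tangentBase R t (Algebra.TensorProduct.map x (AlgHom.id k Q.coord) (Q.nabla f)) := by
  rw [tangentBase_adPoint, ← leftMul_one_tmul]
  rfl

theorem tangentBase_ext {t t' : R ⊗[k] Q.tangent}
    (h : ∀ f, Q.tangentBase R t (1 ⊗ₜ f) = Q.tangentBase R t' (1 ⊗ₜ f)) : t = t' := by
  apply Q.tangentBase_injective R
  ext f
  exact h f

theorem tangentBase_rTensor {S : Type u} [CommRing S] [Algebra k S] (g : R →ₐ[k] S)
    (t : R ⊗[k] Q.tangent) (f : Q.coord) :
    Q.tangentBase S (g.toLinearMap.rTensor Q.tangent t) (1 ⊗ₜ f) =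
      g (Q.tangentBase R t (1 ⊗ₜ f)) := by
  induction t using TensorProduct.induction_on with
  | zero => simp
  | add t₁ t₂ h₁ h₂ => simp only [map_add, LinearMap.add_apply, h₁, h₂]
  | tmul r D => simp [tangentBase_tmul]

/-- The adjoint representation. -/
def adjointRep : MorToGL (k := k) Q.coord Q.tangent where
  app _ _ _ x := Q.adPoint x
  naturality R S _ _ _ _ g x v := by
    apply Q.tangentBase_ext
    intro f
    rw [tangentBase_rTensor, tangentBase_adPoint_one_tmul, tangentBase_adPoint_one_tmul]
    induction Q.nabla f using TensorProduct.induction_on with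
    | zero => simp
    | add t₁ t₂ h₁ h₂ => simp only [map_add, h₁, h₂]
    | tmul a b => simp [tangentBase_tmul]

theorem isAdjointRep_adjointRep : Q.IsAdjointRep Q.adjointRep :=
  fun _ _ _ x t => Q.tangentBase_adPoint x t

theorem eq_adjointRep {Ad : MorToGL (k := k) Q.coord Q.tangent} (h : Q.IsAdjointRep Ad) :
    Ad = Q.adjointRep := by
  apply MorToGL.ext
  funext R _ _ x
  ext t
  apply Q.tangentBase_injective R
  rw [h R x t]
  exact (Q.tangentBase_adPoint x t).symm

/-- At `x = ε + δD`, a term `a ⊗ b` of `∇ f` contributes `ε(a) E(b) + δ D(a) E(b)`. The first parts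
sum to `E f` because `e ▷ y = y`, the second to `(D ⊗ E) (∇ f)`. -/
theorem adjointRep_dualPoint (D E : Q.tangent) :
    Q.adjointRep.app (DualNumber k) (dualPoint Q.counit D) (1 ⊗ₜ E) =
      1 ⊗ₜ E + (DualNumber.eps : DualNumber k) ⊗ₜ Q.bracket D E := by
  apply Q.tangentBase_ext
  intro f
  change Q.tangentBase (DualNumber k) (Q.adPoint _ _) _ = _
  rw [tangentBase_adPoint_one_tmul, map_add, LinearMap.add_apply, tangentBase_tmul,
    tangentBase_tmul, bracket_val, one_mul, one_mul, mul_one]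
  have hε : tensorForm Q.counit.toLinearMap E.1 (Q.nabla f) = E.1 f :=
    congr($(convolve_counit_left (Q.pointOp_counit_left _) E.1) f)
  rw [convolve_apply, ← hε]
  induction Q.nabla f using TensorProduct.induction_on with
  | zero => simp
  | add t₁ t₂ h₁ h₂ => simp only [map_add, h₁, h₂]; ring
  | tmul a b =>
    rw [Algebra.TensorProduct.map_tmul, tangentBase_tmul]
    ext <;> simp [dualPoint, TrivSqZeroExt.algebraMap_eq_inl, mul_comm]

theorem hasDerivAt_adjointRep_iff (ad : Q.tangent →ₗ[k] Module.End k Q.tangent) :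
    Q.adjointRep.HasDerivAt Q.counit ad ↔ ad = Q.bracket := by
  constructor
  · intro h
    apply LinearMap.ext
    intro D
    apply LinearMap.ext
    intro E
    have h' := h D E
    rw [adjointRep_dualPoint, add_right_inj] at h'
    apply Subtype.ext
    ext f
    have := congr(TrivSqZeroExt.snd (Q.tangentBase _ $h' (1 ⊗ₜ f)))
    rw [tangentBase_tmul, tangentBase_tmul] at this
    simpa [TrivSqZeroExt.algebraMap_eq_inl] using this.symm
  · rintro rfl D E
    exact Q.adjointRep_dualPoint D E

end AffRack

/-! ### Conjugation and left-invariant derivations, in terms of comorphisms -/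

section InvariantDerivations

variable {k : Type u} [Field k] {A : Type v} [CommRing A] [Algebra k A] {c : A →ₐ[k] A ⊗[k] A}
  {ε : A →ₐ[k] k}

theorem tensorForm_mul_tmul_one (D : pointDer ε) (E : A →ₗ[k] k) (s : A ⊗[k] A) (b : A) :
    tensorForm D.1 E (s * b ⊗ₜ 1) =
      tensorForm D.1 E s * ε b + tensorForm ε.toLinearMap E s * D.1 b := by
  induction s using TensorProduct.induction_on with
  | zero => simp
  | add s₁ s₂ h₁ h₂ => simp only [add_mul, map_add, h₁, h₂]; ring
  | tmul a a' =>
    simp [D.2 a b]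
    ring

/-- The bracket of the conjugation operation `c` of a group with comultiplication `Δ` is the
commutator, since `(g h g⁻¹) g = g h`. -/
theorem convolve_conj {Δ : A →ₐ[k] A ⊗[k] A}
    (h₁ : pointOp c (constPoint ε A) (AlgHom.id k A) = AlgHom.id k A)
    (h₂ : pointOp Δ (AlgHom.id k A) (constPoint ε A) = AlgHom.id k A)
    (h : pointOp Δ c Algebra.TensorProduct.includeLeft = Δ) (D : pointDer ε) (E : A →ₗ[k] k) :
    convolve c D.1 E = convolve Δ D.1 E - convolve Δ E D.1 := by
  rw [eq_sub_iff_add_eq]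
  -- Written as a convolution over `Δ` with `ε`, this becomes one of the two terms of the product
  -- rule for `D` applied to `c a * (b ⊗ 1)`.
  conv_lhs => rw [← convolve_counit_right h₂ (convolve c D.1 E)]
  ext f
  rw [LinearMap.add_apply, convolve_apply, convolve_apply, convolve_apply]
  conv_rhs => rw [← h, pointOp, AlgHom.comp_apply]
  induction Δ f using TensorProduct.induction_on with
  | zero => simp
  | add t₁ t₂ h₁ h₂ => simp only [map_add, ← h₁, ← h₂]; ring
  | tmul a b =>
    have hl : tensorForm ε.toLinearMap E (c a) = E a := congr($(convolve_counit_left h₁ E) a)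
    rw [Algebra.TensorProduct.productMap_apply_tmul, Algebra.TensorProduct.includeLeft_apply,
      tensorForm_mul_tmul_one, hl]
    simp [convolve_apply]

/-- The linear map `a ⊗ b ↦ D b • a`. -/
def rightForm (D : A →ₗ[k] k) : A ⊗[k] A →ₗ[k] A :=
  (TensorProduct.rid k A).toLinearMap ∘ₗ D.lTensor A

@[simp]
theorem rightForm_tmul (D : A →ₗ[k] k) (a b : A) : rightForm D (a ⊗ₜ b) = D b • a := by
  simp [rightForm]

/-- `id ⊗ D` is a derivation along `id ⊗ ε`. Since `(id ⊗ ε) ∘ Δ = id`, composing with `Δ` gives a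
derivation of `A`. -/
theorem rightForm_mul (D : pointDer ε) (s t : A ⊗[k] A) :
    rightForm D.1 (s * t) = rightForm ε.toLinearMap s * rightForm D.1 t +
      rightForm ε.toLinearMap t * rightForm D.1 s := by
  induction s using TensorProduct.induction_on with
  | zero => simp
  | add s₁ s₂ h₁ h₂ => simp only [add_mul, mul_add, map_add, h₁, h₂]; ring
  | tmul a b =>
    induction t using TensorProduct.induction_on with
    | zero => simp
    | add t₁ t₂ h₁ h₂ => simp only [add_mul, mul_add, map_add, h₁, h₂]; ring
    | tmul a' b' =>
      simp [D.2 b b', Algebra.smul_def]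
      ring

theorem rightForm_counit (h : pointOp c (AlgHom.id k A) (constPoint ε A) = AlgHom.id k A) (f : A) :
    rightForm ε.toLinearMap (c f) = f := by
  conv_rhs => rw [← AlgHom.id_apply (R := k) f, ← h, pointOp, AlgHom.comp_apply]
  induction c f using TensorProduct.induction_on with
  | zero => simp
  | add s₁ s₂ h₁ h₂ => simp only [map_add, h₁, h₂]
  | tmul a b => simp [constPoint_apply, Algebra.smul_def, mul_comm]

/-- The derivation `(id ⊗ D) ∘ Δ` of a point derivation `D`. -/
def invariantDerivation (h : pointOp c (AlgHom.id k A) (constPoint ε A) = AlgHom.id k A)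
    (D : pointDer ε) : Derivation k A A :=
  Derivation.mk' (rightForm D.1 ∘ₗ c.toLinearMap) fun f g => by
    simp [rightForm_mul, rightForm_counit h]

theorem invariantDerivation_apply
    (h : pointOp c (AlgHom.id k A) (constPoint ε A) = AlgHom.id k A) (D : pointDer ε) (f : A) :
    invariantDerivation h D f = rightForm D.1 (c f) := rfl

/-- Coassociativity: both sides apply `id ⊗ id ⊗ D` to one of the two iterated comultiplications of
`f`. -/
theorem comp_invariantDerivation
    (h : pointOp c (AlgHom.id k A) (constPoint ε A) = AlgHom.id k A)
    (ha : pointOp c (pointOp c (threePoint₁ k A) (threePoint₂ k A)) (threePoint₃ k A) =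
      pointOp c (threePoint₁ k A) (pointOp c (threePoint₂ k A) (threePoint₃ k A)))
    (D : pointDer ε) (f : A) :
    c (invariantDerivation h D f) =
      (invariantDerivation h D : A →ₗ[k] A).lTensor A (c f) := by
  have h₂₃ : pointOp c (threePoint₂ k A) (threePoint₃ k A) =
      Algebra.TensorProduct.includeRight.comp c := by
    rw [threePoint₂, threePoint₃, ← comp_pointOp, pointOp_include]
  have hl : c (invariantDerivation h D f) = (rightForm D.1).lTensor A
      (pointOp c (pointOp c (threePoint₁ k A) (threePoint₂ k A)) (threePoint₃ k A) f) := by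
    rw [invariantDerivation_apply]
    conv_rhs => rw [pointOp, AlgHom.comp_apply]
    induction c f using TensorProduct.induction_on with
    | zero => simp
    | add s₁ s₂ h₁ h₂ => simp only [map_add, h₁, h₂]
    | tmul a b =>
      rw [rightForm_tmul, map_smul, Algebra.TensorProduct.productMap_apply_tmul, pointOp,
        AlgHom.comp_apply]
      induction c a using TensorProduct.induction_on with
      | zero => simp
      | add s₁ s₂ h₁ h₂ => simp only [map_add, smul_add, add_mul, h₁, h₂]
      | tmul a₁ a₂ => simp [threePoint₁, threePoint₂, threePoint₃]
  rw [hl, ha, h₂₃]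
  conv_lhs => rw [pointOp, AlgHom.comp_apply]
  induction c f using TensorProduct.induction_on with
  | zero => simp
  | add s₁ s₂ h₁ h₂ => simp only [map_add, h₁, h₂]
  | tmul a b => simp [threePoint₁, invariantDerivation_apply]

theorem apply_rightForm (D E : A →ₗ[k] k) (t : A ⊗[k] A) :
    D (rightForm E t) = tensorForm D E t := by
  induction t using TensorProduct.induction_on with
  | zero => simp
  | add s₁ s₂ h₁ h₂ => simp only [map_add, h₁, h₂]
  | tmul a b => simp [mul_comm]

/-- The value at the unit of a derivation, as a point derivation. -/
def derivationAt (ε : A →ₐ[k] k) : Derivation k A A →ₗ[k] pointDer ε where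
  toFun T := ⟨ε.toLinearMap ∘ₗ (T : A →ₗ[k] A), fun f g => by
    simp
    ring⟩
  map_add' S T := by apply Subtype.ext; ext; simp
  map_smul' r T := by apply Subtype.ext; ext; simp

theorem rightForm_derivationAt (T : Derivation k A A) (t : A ⊗[k] A) :
    rightForm (derivationAt ε T).1 t =
      rightForm ε.toLinearMap ((T : A →ₗ[k] A).lTensor A t) := by
  induction t using TensorProduct.induction_on with
  | zero => simp
  | add s₁ s₂ h₁ h₂ => simp only [map_add, h₁, h₂]
  | tmul a b => simp [derivationAt]

end InvariantDerivations

/-! ### The Lie algebra of an affine algebraic group -/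

section AffineGroups

variable {k : Type u} [Field k] (G : Over (Spec (.of k))) [GrpObj G] [IsAffine G.left]
  {R : Type u} [CommRing R] [Algebra k R]

theorem pointOp_mul_pointHom (φ ψ : specOver k R ⟶ G) :
    pointOp (comorphism μ[G]) (pointHom φ) (pointHom ψ) = pointHom (φ * ψ) :=
  pointOp_pointHom _ φ ψ

omit [IsAffine G.left] in
theorem pointHom_one : pointHom (1 : specOver k R ⟶ G) = constPoint (evalAt η[G]) R :=
  pointHom_toUnit_comp η[G]

theorem pointOp_mul_counit (x : Coord G →ₐ[k] R) :
    pointOp (comorphism μ[G]) x (constPoint (evalAt η[G]) R) = x := by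
  obtain ⟨φ, rfl⟩ : ∃ φ, pointHom φ = x := ⟨_, pointHom_homPoint x⟩
  rw [← pointHom_one, pointOp_mul_pointHom, mul_one]

theorem pointOp_counit_mul (x : Coord G →ₐ[k] R) :
    pointOp (comorphism μ[G]) (constPoint (evalAt η[G]) R) x = x := by
  obtain ⟨φ, rfl⟩ : ∃ φ, pointHom φ = x := ⟨_, pointHom_homPoint x⟩
  rw [← pointHom_one, pointOp_mul_pointHom, one_mul]

theorem pointOp_mul_assoc (x y z : Coord G →ₐ[k] R) :
    pointOp (comorphism μ[G]) (pointOp (comorphism μ[G]) x y) z =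
      pointOp (comorphism μ[G]) x (pointOp (comorphism μ[G]) y z) := by
  obtain ⟨φ, rfl⟩ : ∃ φ, pointHom φ = x := ⟨_, pointHom_homPoint x⟩
  obtain ⟨ψ, rfl⟩ : ∃ φ, pointHom φ = y := ⟨_, pointHom_homPoint y⟩
  obtain ⟨χ, rfl⟩ : ∃ φ, pointHom φ = z := ⟨_, pointHom_homPoint z⟩
  simp only [pointOp_mul_pointHom, mul_assoc]

/-- The comorphism of the conjugation `(g, h) ↦ g h g⁻¹`. -/
def conjComul : Coord G →ₐ[k] Coord G ⊗[k] Coord G :=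
  comorphism (fst G G * snd G G * (fst G G)⁻¹)

theorem pointOp_conj_mul (x y : Coord G →ₐ[k] R) :
    pointOp (comorphism μ[G]) (pointOp (conjComul G) x y) x = pointOp (comorphism μ[G]) x y := by
  obtain ⟨φ, rfl⟩ : ∃ φ, pointHom φ = x := ⟨_, pointHom_homPoint x⟩
  obtain ⟨ψ, rfl⟩ : ∃ φ, pointHom φ = y := ⟨_, pointHom_homPoint y⟩
  have h : lift φ ψ ≫ (fst G G * snd G G * (fst G G)⁻¹) = φ * ψ * φ⁻¹ := by
    simp [MonObj.comp_mul, GrpObj.comp_inv]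
  rw [conjComul, pointOp_pointHom, h, pointOp_mul_pointHom, pointOp_mul_pointHom,
    inv_mul_cancel_right]

theorem comp_mul_conjComul :
    pointOp (comorphism μ[G]) (conjComul G) Algebra.TensorProduct.includeLeft =
      comorphism μ[G] := by
  have h := pointOp_conj_mul G (R := Coord G ⊗[k] Coord G) Algebra.TensorProduct.includeLeft
    Algebra.TensorProduct.includeRight
  rwa [pointOp_include, pointOp_include] at h

theorem invariantDerivation_mem_lieAlg (D : pointDer (evalAt η[G])) :
    invariantDerivation (pointOp_mul_counit G _) D ∈ lieAlg G :=
  comp_invariantDerivation (pointOp_mul_counit G _) (pointOp_mul_assoc G _ _ _) D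

/-- By left-invariance, `(id ⊗ εT) ∘ Δ = (id ⊗ ε) ∘ Δ ∘ T = T`. -/
theorem invariantDerivation_derivationAt (T : lieAlg G) :
    invariantDerivation (pointOp_mul_counit G _) (derivationAt (evalAt η[G]) T.1) = T.1 := by
  ext f
  rw [invariantDerivation_apply, rightForm_derivationAt, ← T.2 f,
    rightForm_counit (pointOp_mul_counit G _)]

/-- Left-invariant derivations are the point derivations at the unit. -/
def lieAlgEquiv : lieAlg G ≃ₗ[k] pointDer (evalAt η[G]) where
  __ := derivationAt (evalAt η[G]) ∘ₗ (lieAlg G).toSubmodule.subtype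
  invFun D := ⟨_, invariantDerivation_mem_lieAlg G D⟩
  left_inv T := Subtype.ext (invariantDerivation_derivationAt G T)
  right_inv D := by
    apply Subtype.ext
    ext f
    have h : tensorForm (evalAt η[G]).toLinearMap D.1 (comorphism μ[G] f) = D.1 f :=
      congr($(convolve_counit_left (pointOp_counit_mul G _) D.1) f)
    rw [← h, ← apply_rightForm]
    rfl

theorem evalAt_lieAlg_lieAlg (S T : lieAlg G) (f : Coord G) :
    evalAt η[G] (S.1 (T.1 f)) =
      convolve (comorphism μ[G]) (lieAlgEquiv G S).1 (lieAlgEquiv G T).1 f := by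
  conv_lhs => rw [← invariantDerivation_derivationAt G T, invariantDerivation_apply]
  exact apply_rightForm (lieAlgEquiv G S).1 (lieAlgEquiv G T).1 _

theorem lieAlgEquiv_lie (S T : lieAlg G) :
    (lieAlgEquiv G ⁅S, T⁆).1 =
      convolve (comorphism μ[G]) (lieAlgEquiv G S).1 (lieAlgEquiv G T).1 -
        convolve (comorphism μ[G]) (lieAlgEquiv G T).1 (lieAlgEquiv G S).1 := by
  ext f
  rw [LinearMap.sub_apply, ← evalAt_lieAlg_lieAlg, ← evalAt_lieAlg_lieAlg, ← map_sub,
    ← Derivation.commutator_apply]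
  rfl

variable [LocallyOfFiniteType G.hom]

theorem bracket_conjRack (D E : (conjRack G).tangent) :
    ((conjRack G).bracket D E).1 =
      convolve (comorphism μ[G]) D.1 E.1 - convolve (comorphism μ[G]) E.1 D.1 :=
  convolve_conj (A := Coord G) (c := conjComul G) (ε := evalAt η[G])
    ((conjRack G).pointOp_counit_left _) (pointOp_mul_counit G _) (comp_mul_conjComul G) D E.1

theorem exists_lieAlg_equiv_tangent :
    ∃ Θ : lieAlg G ≃ₗ[k] (conjRack G).tangent,
      (∀ (T : lieAlg G) (f : Coord G), (Θ T).1 f = evalAt η[G] (T.1 f)) ∧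
      ∀ S T : lieAlg G, Θ ⁅S, T⁆ = (conjRack G).bracket (Θ S) (Θ T) :=
  ⟨lieAlgEquiv G, fun _ _ => rfl, fun S T => Subtype.ext
    ((lieAlgEquiv_lie G S T).trans
      (bracket_conjRack G (lieAlgEquiv G S) (lieAlgEquiv G T)).symm)⟩

end AffineGroups

/-! ### Polynomial equations and the implicit function theorem -/

section PolynomialCalculus

open MvPolynomial

variable {𝕜 : Type*} [RCLike 𝕜] {κ : Type*} [Fintype κ]

theorem contDiff_aeval (F : MvPolynomial κ 𝕜) :
    ContDiff 𝕜 ∞ fun x : κ → 𝕜 => aeval x F := by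
  induction F using MvPolynomial.induction_on with
  | C r => simpa using contDiff_const
  | add F G hF hG => simpa using hF.add hG
  | mul_X F i hF => simpa using hF.mul (contDiff_apply 𝕜 𝕜 i)

theorem differentiableAt_aeval (F : MvPolynomial κ 𝕜) (a : κ → 𝕜) :
    DifferentiableAt 𝕜 (fun x : κ → 𝕜 => aeval x F) a :=
  (contDiff_aeval F).differentiable (by simp) a

/-- The directional derivative of polynomials at a point, as a point derivation. -/
def directionalDer (a v : κ → 𝕜) : pointDer (aeval a : MvPolynomial κ 𝕜 →ₐ[𝕜] 𝕜) where
  val :=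
    { toFun F := fderiv 𝕜 (fun x : κ → 𝕜 => aeval x F) a v
      map_add' F G := by
        simp only [map_add]
        rw [fderiv_fun_add (differentiableAt_aeval F a) (differentiableAt_aeval G a)]
        rfl
      map_smul' r F := by
        simp only [map_smul]
        rw [fderiv_fun_const_smul (differentiableAt_aeval F a)]
        rfl }
  property F G := by
    simp only [LinearMap.coe_mk, AddHom.coe_mk, map_mul]
    rw [fderiv_fun_mul (differentiableAt_aeval F a) (differentiableAt_aeval G a)]
    simp
    ring

theorem directionalDer_apply (a v : κ → 𝕜) (F : MvPolynomial κ 𝕜) :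
    (directionalDer a v).1 F = fderiv 𝕜 (fun x : κ → 𝕜 => aeval x F) a v := rfl

theorem directionalDer_X (a v : κ → 𝕜) (i : κ) : (directionalDer a v).1 (X i) = v i := by
  rw [directionalDer_apply]
  simp only [aeval_X]
  rw [(hasFDerivAt_apply i a).fderiv]
  rfl

/-- A point derivation of a polynomial ring is determined by its values on the variables. This
passes from algebraic to analytic derivatives. -/
theorem eq_directionalDer {a : κ → 𝕜}
    (D : pointDer (aeval a : MvPolynomial κ 𝕜 →ₐ[𝕜] 𝕜)) :
    D = directionalDer a fun i => D.1 (X i) := by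
  apply derEval_injective (adjoin_range_X (R := 𝕜) (σ := κ))
  ext ⟨_, i, rfl⟩
  exact (directionalDer_X a (fun i => D.1 (X i)) i).symm

theorem directionalDer_single [DecidableEq κ] (a : κ → 𝕜) (i : κ) (F : MvPolynomial κ 𝕜) :
    (directionalDer a (Pi.single i 1)).1 F = aeval a (pderiv i F) := by
  let D : pointDer (aeval a : MvPolynomial κ 𝕜 →ₐ[𝕜] 𝕜) :=
    ⟨(aeval a).toLinearMap ∘ₗ
      ((pderiv i : Derivation 𝕜 (MvPolynomial κ 𝕜) (MvPolynomial κ 𝕜)) :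
        MvPolynomial κ 𝕜 →ₗ[𝕜] MvPolynomial κ 𝕜), fun F G => by
      simp
      ring⟩
  have h : D = directionalDer a (Pi.single i 1) := by
    rw [eq_directionalDer D]
    congr 1
    ext j
    by_cases hj : i = j
    · subst hj
      simp [D]
    · simp [D, pderiv_X_of_ne (Ne.symm hj), Ne.symm hj]
  rw [← h]
  rfl

/-- Through every tangent vector `v` at a point `a` of a set of polynomial equations with an
invertible square block of the Jacobian matrix at `a` there passes a smooth curve of solutions. -/
theorem exists_curve_of_det_ne_zero {σ : Type*} [Fintype σ] [DecidableEq σ]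
    (rel : σ → MvPolynomial κ 𝕜) (e : σ → κ) (a v : κ → 𝕜) (ha : ∀ j, aeval a (rel j) = 0)
    (hv : ∀ j, (directionalDer a v).1 (rel j) = 0)
    (hdet : (Matrix.of fun i j => aeval a (pderiv (e i) (rel j))).det ≠ 0) :
    ∃ χ : 𝕜 → κ → 𝕜, χ 0 = a ∧ ContDiffAt 𝕜 ∞ χ 0 ∧ HasDerivAt χ v 0 ∧
      ∀ᶠ t in nhds 0, ∀ j, aeval (χ t) (rel j) = 0 := by
  classical
  let G : (κ → 𝕜) → σ → 𝕜 := fun x j => aeval x (rel j)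
  have hG : ContDiff 𝕜 ∞ G := contDiff_pi.2 fun j => contDiff_aeval (rel j)
  have hG' (x : κ → 𝕜) (j : σ) : fderiv 𝕜 G a x j = (directionalDer a x).1 (rel j) := by
    rw [fderiv_pi fun j => differentiableAt_aeval (rel j) a]
    rfl
  let inc : (σ → 𝕜) →L[𝕜] κ → 𝕜 :=
    LinearMap.toContinuousLinearMap (Fintype.linearCombination 𝕜 fun j => Pi.single (e j) (1 : 𝕜))
  -- The candidate curve is `a + t v` plus a correction `s` in the coordinates `e j` of the Jacobian
  -- block; `s` is then solved for as a function of `t`.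
  let ℓ : 𝕜 × (σ → 𝕜) →L[𝕜] κ → 𝕜 :=
    (ContinuousLinearMap.toSpanSingleton 𝕜 v).coprod inc
  let Φ : 𝕜 × (σ → 𝕜) → σ → 𝕜 := fun u => G (a + ℓ u)
  have hΦ : ContDiffAt 𝕜 ∞ Φ 0 := (hG.comp (contDiff_const.add ℓ.contDiff)).contDiffAt
  have hΦ' : fderiv 𝕜 Φ 0 = fderiv 𝕜 G a ∘L ℓ := by
    have h1 : HasFDerivAt G (fderiv 𝕜 G a) (a + ℓ 0) := by
      rw [map_zero, add_zero]
      exact (hG.differentiable (by simp) a).hasFDerivAt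
    exact (h1.comp 0 (ℓ.hasFDerivAt.const_add a)).fderiv
  -- As `v` is tangent to the equations, the correction vanishes to first order and the curve keeps
  -- velocity `v`.
  have hinl : fderiv 𝕜 Φ 0 ∘L .inl 𝕜 𝕜 (σ → 𝕜) = 0 := by
    ext j
    have : ℓ (1, 0) = v := by simp [ℓ]
    simp [hΦ', this, hG', hv]
  have hinj : Function.Injective (fderiv 𝕜 Φ 0 ∘L .inr 𝕜 𝕜 (σ → 𝕜)) := by
    rw [injective_iff_map_eq_zero]
    intro s hs
    apply Matrix.eq_zero_of_vecMul_eq_zero hdet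
    rw [← hs]
    ext j
    have : ℓ (0, s) = ∑ i, s i • Pi.single (e i) (1 : 𝕜) := by
      simp [ℓ, inc, Fintype.linearCombination_apply]
    rw [hΦ', ContinuousLinearMap.comp_apply, ContinuousLinearMap.comp_apply,
      ContinuousLinearMap.inr_apply, this, map_sum]
    simp only [map_smul, Finset.sum_apply, Pi.smul_apply, hG', directionalDer_single]
    rfl
  have hinv : (fderiv 𝕜 Φ 0 ∘L .inr 𝕜 𝕜 (σ → 𝕜)).IsInvertible :=
    ⟨(LinearEquiv.ofInjectiveEndo _ hinj).toContinuousLinearEquiv, by ext1; rfl⟩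
  have hne : (∞ : WithTop ℕ∞) ≠ 0 := by simp
  let ψ := hΦ.implicitFunction hne hinv
  have hψ0 : ψ 0 = 0 := hΦ.implicitFunction_apply_self hne hinv
  have hψ : ContDiffAt 𝕜 ∞ ψ 0 := hΦ.contDiffAt_implicitFunction hne hinv
  have hψ' : HasFDerivAt ψ (0 : 𝕜 →L[𝕜] σ → 𝕜) 0 := by
    have := (hΦ.hasStrictFDerivAt_implicitFunction hne hinv).hasFDerivAt
    rw [hinl, ContinuousLinearMap.comp_zero, neg_zero] at this
    exact this
  have hpair : HasDerivAt (fun t => (t, ψ t)) ((1 : 𝕜), (0 : σ → 𝕜)) 0 := by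
    have := hψ'.hasDerivAt
    rw [zero_apply] at this
    exact (hasDerivAt_id (0 : 𝕜)).prodMk this
  refine ⟨fun t => a + ℓ (t, ψ t), ?_, ?_, ?_, ?_⟩
  · simp only [hψ0]
    rw [← Prod.zero_eq_mk, map_zero, add_zero]
  · exact contDiffAt_const.add (ℓ.contDiff.contDiffAt.comp 0 (contDiffAt_id.prodMk hψ))
  · have : ℓ (1, 0) = v := by simp [ℓ]
    rw [← this]
    exact (ℓ.hasFDerivAt.comp_hasDerivAt (0 : 𝕜) hpair).const_add a
  · filter_upwards [hΦ.eventually_apply_implicitFunction hne hinv] with t ht j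
    have h0 : Φ 0 = 0 := by
      ext j
      simpa [Φ, G] using ha j
    rw [h0] at ht
    exact congr_fun ht j

end PolynomialCalculus

/-! ### Curves through smooth rational points -/

section SmoothPoints

open MvPolynomial

theorem exists_algHom_of_relation {R S T κ σ : Type*} [CommRing R] [CommRing S] [Algebra R S]
    [CommRing T] [Algebra R T] (P : Algebra.Presentation R S κ σ) (b : κ → T)
    (hb : ∀ j, aeval b (P.relation j) = 0) :
    ∃ q : S →ₐ[R] T, ∀ F : MvPolynomial κ R, q (aeval P.val F) = aeval b F := by
  have hker : RingHom.ker (aeval P.val : MvPolynomial κ R →ₐ[R] S) ≤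
      RingHom.ker (aeval b : MvPolynomial κ R →ₐ[R] T) := by
    have h := P.span_range_relation_eq_ker
    rw [Algebra.Generators.ker_eq_ker_aeval_val] at h
    rw [← h, Ideal.span_le]
    rintro _ ⟨j, rfl⟩
    exact hb j
  have hsurj : Function.Surjective (aeval P.val : MvPolynomial κ R →ₐ[R] S) :=
    fun s => ⟨P.σ s, P.aeval_val_σ s⟩
  refine ⟨AlgHom.liftOfSurjective _ hsurj _ hker, fun F => ?_⟩
  exact AlgHom.liftOfSurjective_apply _ hsurj _ hker F

/-- Through every tangent vector at a smooth rational point there passes a smooth curve of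
rational points. -/
theorem exists_curve_of_isSmoothAt {𝕜 : Type u} [RCLike 𝕜] {A : Type u} [CommRing A]
    [Algebra 𝕜 A] [Algebra.FiniteType 𝕜 A] (ε : A →ₐ[𝕜] 𝕜)
    (hs : Algebra.IsSmoothAt 𝕜 (RingHom.ker ε)) (D : pointDer ε) :
    ∃ χ : 𝕜 → (A →ₐ[𝕜] 𝕜), χ 0 = ε ∧
      ∀ f, ContDiffAt 𝕜 ∞ (fun t => χ t f) 0 ∧ HasDerivAt (fun t => χ t f) (D.1 f) 0 := by
  classical
  have : Algebra.FinitePresentation 𝕜 A := Algebra.FinitePresentation.of_finiteType.1 inferInstance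
  obtain ⟨g, hg, hstd⟩ := Algebra.IsSmoothAt.exists_notMem_isStandardSmooth 𝕜 (RingHom.ker ε)
  obtain ⟨κ, σ, _, _, ⟨P⟩⟩ := hstd.out
  cases nonempty_fintype κ
  cases nonempty_fintype σ
  -- A dual number is a unit if its constant term is. Here `ε g ≠ 0`, so the tangent vector `ε + δD`
  -- extends to the standard smooth localization at `g`.
  have hunit (y : Submonoid.powers g) : IsUnit (dualPoint ε D y) := by
    obtain ⟨_, n, rfl⟩ := y
    simp only [map_pow]
    apply IsUnit.pow
    rw [TrivSqZeroExt.isUnit_iff_isUnit_fst]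
    simpa [dualPoint] using hg
  let p : Localization.Away g →ₐ[𝕜] DualNumber 𝕜 :=
    IsLocalization.liftAlgHom (M := Submonoid.powers g) hunit
  have hp (f : A) : p (algebraMap A _ f) = dualPoint ε D f := IsLocalization.lift_eq _ _
  -- In the coordinates of the presentation, the constant part of `p` is the point `a` and the
  -- `δ`-part is the tangent vector `v`.
  let a : κ → 𝕜 := fun i => (p (P.val i)).fst
  have hfst (F : MvPolynomial κ 𝕜) : (p (aeval P.val F)).fst = aeval a F := by
    have : ((TrivSqZeroExt.fstHom 𝕜 𝕜 𝕜).comp p).comp (aeval P.val) = aeval a := by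
      ext i; simp [a]
    exact congr($this F)
  let D' : pointDer (aeval a : MvPolynomial κ 𝕜 →ₐ[𝕜] 𝕜) :=
    ⟨TrivSqZeroExt.sndHom 𝕜 𝕜 ∘ₗ p.toLinearMap ∘ₗ (aeval P.val).toLinearMap, fun F G => by
      simp [← hfst]
      ring⟩
  let v : κ → 𝕜 := fun i => D'.1 (X i)
  have hsnd (F : MvPolynomial κ 𝕜) : (p (aeval P.val F)).snd = (directionalDer a v).1 F :=
    congr(($(eq_directionalDer D')).1 F)
  obtain ⟨χ, hχ0, hχc, hχd, hχ⟩ := exists_curve_of_det_ne_zero P.relation P.map a v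
    (fun j => by rw [← hfst, P.aeval_val_relation, map_zero, TrivSqZeroExt.fst_zero])
    (fun j => by rw [← hsnd, P.aeval_val_relation, map_zero, TrivSqZeroExt.snd_zero])
    (by
      -- Standard smoothness says that the Jacobian is a unit, so its value at `a` is nonzero.
      have h1 := (P.jacobian_isUnit.map ((TrivSqZeroExt.fstHom 𝕜 𝕜 𝕜).comp p)).ne_zero
      rw [P.jacobian_eq_jacobiMatrix_det, Algebra.Generators.algebraMap_apply] at h1
      change (p (aeval P.val P.jacobiMatrix.det)).fst ≠ 0 at h1
      rw [hfst, AlgHom.map_det] at h1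
      convert h1 using 2
      ext i j
      simp [P.jacobiMatrix_apply])
  choose q hq using fun b hb => exists_algHom_of_relation P.toPresentation (T := 𝕜) b hb
  -- The equations hold only for `t` near `0`. The default `ε` makes `Γ t` a rational point for
  -- every `t` and does not affect the germ at `0`.
  let Γ : 𝕜 → (A →ₐ[𝕜] 𝕜) := fun t =>
    if h : ∀ j, aeval (χ t) (P.relation j) = 0 then
      (q (χ t) h).comp (IsScalarTower.toAlgHom 𝕜 A (Localization.Away g)) else ε
  have hΓ {t : 𝕜} (h : ∀ j, aeval (χ t) (P.relation j) = 0) (f : A) (F : MvPolynomial κ 𝕜)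
      (hF : aeval P.val F = algebraMap A (Localization.Away g) f) : Γ t f = aeval (χ t) F := by
    simp only [Γ, dif_pos h]
    rw [← hq (χ t) h, hF]
    rfl
  refine ⟨Γ, ?_, fun f => ?_⟩
  · ext f
    have hF := P.aeval_val_σ (algebraMap A (Localization.Away g) f)
    rw [hΓ hχ.self_of_nhds f _ hF, hχ0, ← hfst, hF, hp]
    simp [dualPoint]
  · have hF := P.aeval_val_σ (algebraMap A (Localization.Away g) f)
    set F := P.σ (algebraMap A (Localization.Away g) f)
    have hev : (fun t => Γ t f) =ᶠ[nhds 0] fun t => aeval (χ t) F := by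
      filter_upwards [hχ] with t ht
      exact hΓ ht f F hF
    constructor
    · exact (((contDiff_aeval F).contDiffAt).comp 0 hχc).congr_of_eventuallyEq hev
    · have h1 := (differentiableAt_aeval F (χ 0)).hasFDerivAt.comp_hasDerivAt (0 : 𝕜) hχd
      have h2 : D.1 f = fderiv 𝕜 (fun x : κ → 𝕜 => aeval x F) (χ 0) v := by
        rw [hχ0, ← directionalDer_apply, ← hsnd, hF, hp]
        simp [dualPoint]
      rw [h2]
      exact h1.congr_of_eventuallyEq hev

end SmoothPoints

/-! ### Immersions, embeddings and lifting of curves -/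

section Embeddings

open Manifold Topology

variable {𝕜 : Type*} [NontriviallyNormedField 𝕜] {E : Type*} [NormedAddCommGroup E]
  [NormedSpace 𝕜 E] {F : Type*} [NormedAddCommGroup F] [NormedSpace 𝕜 F] {M : Type*}
  [TopologicalSpace M] [ChartedSpace E M]

theorem mdifferentiable_of_mem_maximalAtlas {e : OpenPartialHomeomorph M E}
    (h : e ∈ IsManifold.maximalAtlas 𝓘(𝕜, E) ∞ M) : e.MDifferentiable 𝓘(𝕜, E) 𝓘(𝕜, E) :=
  ⟨(contMDiffOn_of_mem_maximalAtlas h).mdifferentiableOn (by simp),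
    (contMDiffOn_symm_of_mem_maximalAtlas h).mdifferentiableOn (by simp)⟩

/-- The derivative of an immersion is injective. -/
theorem mfderiv_injective_of_isImmersionAt [IsManifold 𝓘(𝕜, E) ∞ M] {f : M → F} {x : M}
    (h : IsImmersionAt 𝓘(𝕜, E) 𝓘(𝕜, F) ∞ f x) :
    Function.Injective (mfderiv 𝓘(𝕜, E) 𝓘(𝕜, F) f x) := by
  have hdom := mdifferentiable_of_mem_maximalAtlas h.domChart_mem_maximalAtlas
  have hcod := mdifferentiable_of_mem_maximalAtlas h.codChart_mem_maximalAtlas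
  let p : F →L[𝕜] E := (ContinuousLinearMap.fst 𝕜 E h.complement).comp
    (h.equiv.symm : F →L[𝕜] E × h.complement)
  -- In suitable charts an immersion is `u ↦ (u, 0)`. Projecting back recovers the chart of `M`,
  -- whose derivative is injective, so that of `f` is too.
  have heq : h.domChart =ᶠ[𝓝 x] (p ∘ h.codChart) ∘ f := by
    filter_upwards [h.domChart.open_source.mem_nhds h.mem_domChart_source] with y hy
    have h1 : (h.codChart.extend 𝓘(𝕜, F) ∘ f ∘ (h.domChart.extend 𝓘(𝕜, E)).symm)
        (h.domChart y) = (h.equiv ∘ (·, 0)) (h.domChart y) := h.writtenInCharts (by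
      simpa using h.domChart.map_source hy)
    simp only [mfld_simps, h.domChart.left_inv hy] at h1
    simp [p, h1]
  have hf : MDifferentiableAt 𝓘(𝕜, E) 𝓘(𝕜, F) f x := h.contMDiffAt.mdifferentiableAt (by simp)
  have hp : MDifferentiableAt 𝓘(𝕜, F) 𝓘(𝕜, E) (p ∘ h.codChart) (f x) :=
    p.differentiableAt.mdifferentiableAt.comp (f x) (hcod.mdifferentiableAt h.mem_codChart_source)
  have h2 := hdom.mfderiv_injective h.mem_domChart_source
  rw [heq.mfderiv_eq, mfderiv_comp x hp hf] at h2
  exact Function.Injective.of_comp h2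

/-- The velocity of a smooth curve in an embedded submanifold is tangent to it. -/
theorem exists_mfderiv_eq_of_curve {f : M → F} {x : M}
    (h : IsSmoothEmbedding 𝓘(𝕜, E) 𝓘(𝕜, F) ∞ f) {c : 𝕜 → F} {v : F} (h0 : c 0 = f x)
    (hc : ContDiffAt 𝕜 ∞ c 0) (hv : HasDerivAt c v 0) (hr : ∀ t, c t ∈ Set.range f) :
    ∃ w : E, mfderiv 𝓘(𝕜, E) 𝓘(𝕜, F) f x w = v := by
  choose s hs using hr
  have hs0 : s 0 = x := h.isEmbedding.injective ((hs 0).trans h0)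
  have hfs : f ∘ s = c := funext hs
  have himm : IsImmersionAt 𝓘(𝕜, E) 𝓘(𝕜, F) ∞ f (s 0) := h.isImmersion.isImmersionAt _
  -- The lift is continuous because `f` is a topological embedding; a continuous lift of a smooth
  -- curve through an immersion is smooth.
  have hcont : ContinuousAt s 0 := by
    rw [h.isEmbedding.isInducing.continuousAt_iff, hfs]
    exact hc.continuousAt
  have hsm : ContMDiffAt 𝓘(𝕜, 𝕜) 𝓘(𝕜, E) ∞ s 0 :=
    (ContMDiffAt.iff_comp_isImmersionAt himm).2 ⟨hcont, by rw [hfs]; exact hc.contMDiffAt⟩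
  have hcomp := mfderiv_comp (0 : 𝕜) (himm.contMDiffAt.mdifferentiableAt (by simp))
    (hsm.mdifferentiableAt (by simp))
  rw [hfs, mfderiv_eq_fderiv] at hcomp
  rw [← hs0]
  refine ⟨mfderiv 𝓘(𝕜, 𝕜) 𝓘(𝕜, E) s 0 (1 : 𝕜), ?_⟩
  have h1 : fderiv 𝕜 c 0 1 = v := by rw [hv.hasFDerivAt.fderiv]; simp
  rw [← h1]
  exact congr($hcomp (1 : 𝕜)).symm

end Embeddings

/-! ### Comparison with the Lie rack of rational points -/

section LieRacks

variable {𝕜 : Type u} [RCLike 𝕜] {E : Type v} [NormedAddCommGroup E] [NormedSpace 𝕜 E]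
  {M : Type w} [TopologicalSpace M] [ChartedSpace E M]

namespace LieRack

variable (L : LieRack 𝕜 E M)

theorem contMDiff_op_left (x : M) : ContMDiff 𝓘(𝕜, E) 𝓘(𝕜, E) ∞ (L.op x) :=
  L.smooth_op.comp (contMDiff_const.prodMk contMDiff_id)

theorem mdifferentiableAt_op (x y : M) : MDifferentiableAt 𝓘(𝕜, E) 𝓘(𝕜, E) (L.op x) y :=
  (L.contMDiff_op_left x).mdifferentiableAt (by simp)

theorem mdifferentiableAt_Ad [IsManifold 𝓘(𝕜, E) ∞ M] :
    MDifferentiableAt 𝓘(𝕜, E) 𝓘(𝕜, E →L[𝕜] E) L.Ad L.unit := by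
  have h := ContMDiffAt.mfderiv (I := 𝓘(𝕜, E)) (I' := 𝓘(𝕜, E)) (J := 𝓘(𝕜, E)) (m := 1) (n := ∞)
    (x₀ := L.unit) L.op (fun _ => L.unit) L.smooth_op.contMDiffAt contMDiffAt_const
    (WithTop.coe_le_coe.2 (le_top : (1 + 1 : ℕ∞) ≤ ⊤))
  -- Since `L_x` fixes the unit, source and target of every `Ad_x` are the same tangent space. The
  -- coordinate changes are identities, so smoothness in tangent coordinates is smoothness of `Ad`
  -- itself.
  have hcoord (φ : M → E →L[𝕜] E) : inTangentCoordinates 𝓘(𝕜, E) 𝓘(𝕜, E) (fun _ => L.unit)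
      (fun x => L.op x L.unit) φ L.unit = φ := by
    funext x
    have hmem : L.unit ∈ (chartAt E L.unit).source := mem_chart_source E L.unit
    rw [inTangentCoordinates_eq (x₀ := L.unit) (x := x) (fun _ => L.unit)
      (fun x => L.op x L.unit) φ hmem (by rw [L.fixed, L.fixed]; exact hmem), L.fixed, L.fixed]
    ext v
    have hself (w : E) := (tangentBundleCore 𝓘(𝕜, E) M).coordChange_self
      (achart E L.unit) L.unit hmem w
    rw [ContinuousLinearMap.comp_apply, ContinuousLinearMap.comp_apply]
    exact (hself _).trans (congrArg (φ x) (hself v))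
  have h' : ContMDiffAt 𝓘(𝕜, E) 𝓘(𝕜, E →L[𝕜] E) 1 L.Ad L.unit := by
    rw [← hcoord L.Ad]
    exact h
  exact h'.mdifferentiableAt (by simp)

theorem hasMFDerivAt_Ad_apply [IsManifold 𝓘(𝕜, E) ∞ M] (Y : E) :
    HasMFDerivAt 𝓘(𝕜, E) 𝓘(𝕜, E) (fun x => L.Ad x Y) L.unit
      ((ContinuousLinearMap.apply 𝕜 E Y).comp L.ad : E →L[𝕜] E) :=
  (ContinuousLinearMap.apply 𝕜 E Y).hasMFDerivAt.comp L.unit L.mdifferentiableAt_Ad.hasMFDerivAt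

end LieRack

namespace IsLieRackOfPoints

variable {Q : AffRack 𝕜} {L : LieRack 𝕜 E M} {j : M ≃ (Q.coord →ₐ[𝕜] 𝕜)}

theorem contMDiff_eval (h : IsLieRackOfPoints Q L j) (f : Q.coord) :
    ContMDiff 𝓘(𝕜, E) 𝓘(𝕜, 𝕜) ∞ fun m => j m f := by
  obtain ⟨n, g, hg, hemb⟩ := h.embedded
  have hf : f ∈ Algebra.adjoin 𝕜 (Set.range g) := hg ▸ Algebra.mem_top
  induction hf using Algebra.adjoin_induction with
  | mem x hx =>
    obtain ⟨i, rfl⟩ := hx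
    exact contMDiff_pi_space.1 hemb.contMDiff i
  | algebraMap r => simpa using contMDiff_const
  | add x y _ _ hx hy => exact (hx.add hy).congr fun m => map_add (j m) x y
  | mul x y _ _ hx hy => exact (hx.smul hy).congr fun m => map_mul (j m) x y

variable (L j) in
/-- The derivative at the unit of a regular function. -/
def evalDeriv (f : Q.coord) : E →L[𝕜] 𝕜 :=
  mfderiv 𝓘(𝕜, E) 𝓘(𝕜, 𝕜) (fun m => j m f) L.unit

theorem hasMFDerivAt_eval (h : IsLieRackOfPoints Q L j) (f : Q.coord) :
    HasMFDerivAt 𝓘(𝕜, E) 𝓘(𝕜, 𝕜) (fun m => j m f) L.unit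
      (evalDeriv L j f : E →L[𝕜] 𝕜) :=
  ((h.contMDiff_eval f).mdifferentiableAt (by simp)).hasMFDerivAt

theorem evalDeriv_eq (f : Q.coord) {d : E →L[𝕜] 𝕜}
    (hd : HasMFDerivAt 𝓘(𝕜, E) 𝓘(𝕜, 𝕜) (fun m => j m f) L.unit d) : evalDeriv L j f = d :=
  hd.mfderiv

theorem evalDeriv_add (h : IsLieRackOfPoints Q L j) (f g : Q.coord) :
    evalDeriv L j (f + g) = evalDeriv L j f + evalDeriv L j g := by
  apply evalDeriv_eq
  exact ((h.hasMFDerivAt_eval f).add (h.hasMFDerivAt_eval g)).congr_of_eventuallyEq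
    (.of_forall fun m => map_add (j m) f g)

theorem evalDeriv_smul (h : IsLieRackOfPoints Q L j) (r : 𝕜) (f : Q.coord) :
    evalDeriv L j (r • f) = r • evalDeriv L j f := by
  apply evalDeriv_eq
  exact ((h.hasMFDerivAt_eval f).const_smul r).congr_of_eventuallyEq
    (.of_forall fun m => map_smul (j m) r f)

theorem evalDeriv_mul (h : IsLieRackOfPoints Q L j) (f g : Q.coord) :
    evalDeriv L j (f * g) = Q.counit f • evalDeriv L j g + Q.counit g • evalDeriv L j f := by
  apply evalDeriv_eq
  rw [← h.unit]
  exact ((h.hasMFDerivAt_eval f).mul (h.hasMFDerivAt_eval g)).congr_of_eventuallyEq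
    (.of_forall fun m => map_mul (j m) f g)

/-- The comparison map `T_e Q(𝕜) → 𝔮`. -/
def tangentComparison (h : IsLieRackOfPoints Q L j) : E →ₗ[𝕜] Q.tangent where
  toFun v :=
    ⟨{ toFun f := evalDeriv L j f v
       map_add' f g := by rw [h.evalDeriv_add]; rfl
       map_smul' r f := by rw [h.evalDeriv_smul]; rfl }, fun f g => by
      simp [h.evalDeriv_mul]
      ring⟩
  map_add' v w := by apply Subtype.ext; ext; simp
  map_smul' r v := by apply Subtype.ext; ext; simp

theorem tangentComparison_apply (h : IsLieRackOfPoints Q L j) (v : E) (f : Q.coord) :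
    (h.tangentComparison v).1 f = evalDeriv L j f v := rfl

/-- Differentiate `f (x ▷ y) = ∑ a(x) b(y)` in `y` at the unit. The right side is again a
combination of regular functions of `x`, ready for the second derivative. -/
theorem evalDeriv_Ad (h : IsLieRackOfPoints Q L j) (x : M) (Y : E) (f : Q.coord) :
    evalDeriv L j f (L.Ad x Y) =
      tensorForm (j x).toLinearMap (h.tangentComparison Y).1 (Q.nabla f) := by
  have h1 : HasMFDerivAt 𝓘(𝕜, E) 𝓘(𝕜, 𝕜) (fun y => j (L.op x y) f) L.unit
      ((evalDeriv L j f).comp (L.Ad x) : E →L[𝕜] 𝕜) := by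
    refine HasMFDerivAt.comp (g := fun m => j m f) L.unit ?_
      (L.mdifferentiableAt_op x L.unit).hasMFDerivAt
    rw [L.fixed]
    exact h.hasMFDerivAt_eval f
  have h2 (t : Q.coord ⊗[𝕜] Q.coord) : ∃ d : E →L[𝕜] 𝕜,
      HasMFDerivAt 𝓘(𝕜, E) 𝓘(𝕜, 𝕜)
        (fun y => Algebra.TensorProduct.productMap (j x) (j y) t) L.unit d ∧
      d Y = tensorForm (j x).toLinearMap (h.tangentComparison Y).1 t := by
    induction t using TensorProduct.induction_on with
    | zero => exact ⟨0, (hasMFDerivAt_const (0 : 𝕜) L.unit).congr_of_eventuallyEq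
      (.of_forall fun y => map_zero _), by simp⟩
    | add s t hs ht =>
      obtain ⟨d, hd, hdY⟩ := hs
      obtain ⟨d', hd', hdY'⟩ := ht
      exact ⟨d + d', (hd.add hd').congr_of_eventuallyEq (.of_forall fun y => map_add _ s t),
        by simp [hdY, hdY']⟩
    | tmul a b =>
      refine ⟨j x a • evalDeriv L j b, ?_, rfl⟩
      exact ((h.hasMFDerivAt_eval b).const_smul (j x a)).congr_of_eventuallyEq
        (.of_forall fun y => Algebra.TensorProduct.productMap_apply_tmul (j x) (j y) a b)
  obtain ⟨d, hd, hdY⟩ := h2 (Q.nabla f)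
  have hop : (fun y => j (L.op x y) f) =
      fun y => Algebra.TensorProduct.productMap (j x) (j y) (Q.nabla f) := by
    funext y
    rw [h.op]
    rfl
  rw [hop] at h1
  rw [← hdY]
  exact congr($(hasMFDerivAt_unique h1 hd) Y)

theorem tangentComparison_bracket [IsManifold 𝓘(𝕜, E) ∞ M] (h : IsLieRackOfPoints Q L j)
    (X Y : E) :
    (h.tangentComparison (L.bracket X Y)).1 =
      convolve Q.nabla (h.tangentComparison X).1 (h.tangentComparison Y).1 := by
  ext f
  have h1 : HasMFDerivAt 𝓘(𝕜, E) 𝓘(𝕜, 𝕜) (fun x => evalDeriv L j f (L.Ad x Y)) L.unit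
      ((evalDeriv L j f).comp ((ContinuousLinearMap.apply 𝕜 E Y).comp L.ad) : E →L[𝕜] 𝕜) :=
    (evalDeriv L j f).hasMFDerivAt.comp L.unit (L.hasMFDerivAt_Ad_apply Y)
  -- Existence and value of the derivative are proved together, so that the induction on tensors can
  -- add them.
  have h2 (t : Q.coord ⊗[𝕜] Q.coord) : ∃ d : E →L[𝕜] 𝕜,
      HasMFDerivAt 𝓘(𝕜, E) 𝓘(𝕜, 𝕜)
        (fun x => tensorForm (j x).toLinearMap (h.tangentComparison Y).1 t) L.unit d ∧
      d X = tensorForm (h.tangentComparison X).1 (h.tangentComparison Y).1 t := by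
    induction t using TensorProduct.induction_on with
    | zero => exact ⟨0, (hasMFDerivAt_const (0 : 𝕜) L.unit).congr_of_eventuallyEq
      (.of_forall fun y => map_zero _), by simp⟩
    | add s t hs ht =>
      obtain ⟨d, hd, hdX⟩ := hs
      obtain ⟨d', hd', hdX'⟩ := ht
      exact ⟨d + d', (hd.add hd').congr_of_eventuallyEq (.of_forall fun y => map_add _ s t),
        by simp [hdX, hdX']⟩
    | tmul a b =>
      refine ⟨evalDeriv L j b Y • evalDeriv L j a, ?_, ?_⟩
      · exact ((h.hasMFDerivAt_eval a).const_smul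
          (evalDeriv L j b Y)).congr_of_eventuallyEq (.of_forall fun x =>
            (tensorForm_tmul _ _ a b).trans (mul_comm _ _))
      · simp [tangentComparison_apply, mul_comm]
  obtain ⟨d, hd, hdX⟩ := h2 (Q.nabla f)
  rw [convolve_apply, ← hdX]
  have h3 := hd.congr_of_eventuallyEq (.of_forall fun x => h.evalDeriv_Ad x Y f)
  exact congr($(hasMFDerivAt_unique h1 h3) X)

/-- This links the geometry of the embedding to `θ`: the coordinates of an embedded tangent vector
are the values of `θ v` on the generators. -/
theorem mfderiv_embedding_apply (h : IsLieRackOfPoints Q L j) {n : ℕ} (g : Fin n → Q.coord)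
    (v : E) (i : Fin n) :
    (mfderiv 𝓘(𝕜, E) 𝓘(𝕜, Fin n → 𝕜) (fun m i => j m (g i)) L.unit v : Fin n → 𝕜) i =
      evalDeriv L j (g i) v := by
  have h1 : MDifferentiableAt 𝓘(𝕜, E) 𝓘(𝕜, Fin n → 𝕜) (fun m i => j m (g i)) L.unit :=
    (contMDiff_pi_space.2 fun i => h.contMDiff_eval (g i)).mdifferentiableAt
      (n := ∞) (by simp)
  have h2 := (ContinuousLinearMap.proj (R := 𝕜) (φ := fun _ : Fin n => 𝕜) i).hasMFDerivAt.comp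
    L.unit h1.hasMFDerivAt
  exact congr($(hasMFDerivAt_unique h2 (h.hasMFDerivAt_eval (g i))) v)

theorem tangentComparison_injective [IsManifold 𝓘(𝕜, E) ∞ M] (h : IsLieRackOfPoints Q L j) :
    Function.Injective h.tangentComparison := by
  obtain ⟨n, g, hg, hemb⟩ := h.embedded
  intro v w hvw
  apply mfderiv_injective_of_isImmersionAt (hemb.isImmersion.isImmersionAt L.unit)
  funext i
  refine (h.mfderiv_embedding_apply g v i).trans
    (Eq.trans ?_ (h.mfderiv_embedding_apply g w i).symm)
  exact congr(($hvw).1 (g i))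

theorem tangentComparison_surjective [IsManifold 𝓘(𝕜, E) ∞ M] (h : IsLieRackOfPoints Q L j)
    (hs : Algebra.IsSmoothAt 𝕜 (RingHom.ker Q.counit)) :
    Function.Surjective h.tangentComparison := by
  intro D
  obtain ⟨n, g, hg, hemb⟩ := h.embedded
  obtain ⟨c, hc0, hc⟩ := exists_curve_of_isSmoothAt Q.counit hs D
  obtain ⟨w, hw⟩ := exists_mfderiv_eq_of_curve (x := L.unit) (c := fun t i => c t (g i))
    (v := fun i => D.1 (g i)) hemb (by rw [hc0, h.unit])
    (contDiffAt_pi.2 fun i => (hc (g i)).1) (hasDerivAt_pi.2 fun i => (hc (g i)).2)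
    (fun t => ⟨j.symm (c t), by simp⟩)
  -- The velocity of the curve of points has coordinates `D (g i)`, and a point derivation is
  -- determined by its values on generators.
  refine ⟨w, derEval_injective hg ?_⟩
  ext ⟨_, i, rfl⟩
  exact (h.mfderiv_embedding_apply g w i).symm.trans (congr_fun hw i)

end IsLieRackOfPoints

end LieRacks

end

end AlgRack

theorem theorem1p1 :
    (∀ (k : Type u) [Field k],
      ∃ (br : ∀ Q : AffRack k, Q.tangent →ₗ[k] Q.tangent →ₗ[k] Q.tangent)
        (jac : ∀ Q : AffRack k, IsLeibnizBracket (k := k) (V := Q.tangent) (br Q))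
        (d : ∀ {Q R : AffRack k}, (Q ⟶ R) → Q.tangent →ₗ[k] R.tangent)
        (hd : ∀ {Q R : AffRack k} (φ : Q ⟶ R) (D E : Q.tangent),
          d φ (br Q D E) = br R (d φ D) (d φ E)),
        -- the bracket is convolution
        (∀ (Q : AffRack k) (D E : Q.tangent),
          (br Q D E).1 = convolve Q.nabla D.1 E.1) ∧
        -- `d φ` is the derivative `D ↦ D ∘ φ^♯` of `φ` at the unit
        (∀ {Q R : AffRack k} (φ : Q ⟶ R) (D : Q.tangent),
          (d φ D).1 = D.1 ∘ₗ (AffRack.comap φ).toLinearMap) ∧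
        -- these data form a functor
        (∃ F : AffRack k ⥤ LeibAlg k,
          F.toPrefunctor =
            { obj := fun Q : AffRack k => LeibAlg.of (k := k) (V := Q.tangent) (br Q) (jac Q)
              map := fun {Q R : AffRack k} (φ : Q ⟶ R) =>
                LeibAlg.ofHom (k := k) (V := Q.tangent) (W := R.tangent) (d φ) (hd φ) }) ∧
        -- the bracket is the derivative of the adjoint representation
        (∀ Q : AffRack k,
          (∀ (R : Type u) [CommRing R] [Algebra k R],
            Function.Injective (Q.tangentBase R) ∧
              LinearMap.range (Q.tangentBase R) = pointDer (Q.counitBase R)) ∧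
          ∃ Ad : MorToGL (k := k) Q.coord Q.tangent,
            Q.IsAdjointRep Ad ∧ (∀ Ad', Q.IsAdjointRep Ad' → Ad' = Ad) ∧
            ∀ ad : Q.tangent →ₗ[k] Module.End k Q.tangent,
              Ad.HasDerivAt Q.counit ad ↔ ad = br Q) ∧
        -- for a conjugation quandle scheme it is the Lie algebra of the group
        (∀ (G : Over (Spec (.of k))) [GrpObj G] [IsAffine G.left] [LocallyOfFiniteType G.hom],
          (∀ D E : (conjRack G).tangent,
            (br (conjRack G) D E).1 =
              convolve (comorphism μ[G]) D.1 E.1 - convolve (comorphism μ[G]) E.1 D.1) ∧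
          ∃ Θ : lieAlg G ≃ₗ[k] (conjRack G).tangent,
            (∀ (T : lieAlg G) (f : Coord G),
              (Θ T).1 f = evalAt η[G] (T.1 f)) ∧
            ∀ S T : lieAlg G, Θ ⁅S, T⁆ = br (conjRack G) (Θ S) (Θ T))) ∧
    -- over `ℝ` or `ℂ` it is the Leibniz algebra of the Lie rack of rational points
    (∀ (𝕜 : Type u) [RCLike 𝕜] (Q : AffRack 𝕜)
      (E : Type v) [NormedAddCommGroup E] [NormedSpace 𝕜 E] [FiniteDimensional 𝕜 E]
      (M : Type w) [TopologicalSpace M] [ChartedSpace E M] [IsManifold 𝓘(𝕜, E) ∞ M]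
      (L : LieRack 𝕜 E M) (j : M ≃ (Q.coord →ₐ[𝕜] 𝕜)), IsLieRackOfPoints Q L j →
      (∀ x : M, MDifferentiableAt 𝓘(𝕜, E) 𝓘(𝕜, E) (L.op x) L.unit) ∧
      MDifferentiableAt 𝓘(𝕜, E) 𝓘(𝕜, E →L[𝕜] E) L.Ad L.unit ∧
      ∃ θ : E →ₗ[𝕜] Q.tangent,
        (∀ f : Q.coord,
          HasMFDerivAt 𝓘(𝕜, E) 𝓘(𝕜, 𝕜) (fun m => j m f) L.unit
            (LinearMap.toContinuousLinearMap
              (LinearMap.applyₗ f ∘ₗ Q.tangent.subtype ∘ₗ θ) : E →L[𝕜] 𝕜)) ∧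
        (∀ X Y : E, (θ (L.bracket X Y)).1 = convolve Q.nabla (θ X).1 (θ Y).1) ∧
        Function.Injective θ ∧
        (Algebra.IsSmoothAt 𝕜 (RingHom.ker Q.counit) → Function.Surjective θ)) := by
  refine ⟨fun k _ => ?_, fun 𝕜 _ Q E _ _ _ M _ _ _ L j h => ?_⟩
  · exact ⟨AffRack.bracket, AffRack.isLeibnizBracket_bracket, AffRack.tangentMap,
      AffRack.tangentMap_bracket, fun _ _ _ => rfl, fun _ _ => rfl,
      ⟨AffRack.tangentFunctor k, rfl⟩,
      fun Q => ⟨fun R _ _ => ⟨Q.tangentBase_injective R, Q.range_tangentBase R⟩,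
        Q.adjointRep, Q.isAdjointRep_adjointRep, fun _ => Q.eq_adjointRep,
        Q.hasDerivAt_adjointRep_iff⟩,
      fun G _ _ _ => ⟨bracket_conjRack G, exists_lieAlg_equiv_tangent G⟩⟩
  · exact ⟨fun x => L.mdifferentiableAt_op x L.unit, L.mdifferentiableAt_Ad,
      h.tangentComparison, h.hasMFDerivAt_eval, h.tangentComparison_bracket,
      h.tangentComparison_injective, h.tangentComparison_surjective⟩
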